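/- Let $H$ be a finite simple graph with $v=v_H$ vertices, $e=e_H$ edges and minimum degree $\delta=\delta_H$, and put $s=\min\{v-1,\,e-\delta+1\}$. For an integer $n$ and $p\in[0,1]$ let $X=X_H$ be the number of copies of $H$ in the binomial random graph $G_{n,p}$ (that is, the number of not necessarily induced subgraphs of $G_{n,p}$ isomorphic to $H$), and let $\mu=\mathbb{E}X$. For a graph $J$ with $v_J$ vertices and $e_J$ edges write $d(J)=e_J/v_J$ and $d_2(J)=(e_J-1)/(v_J-2)$. Call $H$ *strictly balanced* if $e_H\ge 1$ and $d(H)>d(J)$ for all subgraphs $J\subsetneq H$ with $v_J\ge 1$; call $H$ *$2$-balanced* if $e_H\ge 2$ and $d_2(H)\ge d_2(J)$ for all subgraphs $J\subsetneq H$ with $v_J\ge 3$. (i) If $H$ is strictly balanced, then there is $C=C(H)\ge 1$ such that for every $\Lambda>0$ there is $c=c(\Lambda,H)>0$ such that for all $n\ge v$, $\varepsilon\in(0,\Lambda]$ and $p\in[0,1]$ satisfying $\mu^{(s-1)/s}\le\Lambda\log n$ we have $$\mathbb{P}\bigl(X\ge(1+\varepsilon)\mu\bigr)\le C\exp\bigl(-c\,\varepsilon^2\mu\bigr).$$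 (ii) If $H$ is strictly balanced, then there are $n_0,c,C,\xi>0$, depending only on $H$, such that for all $n\ge n_0$, $p\in[0,1]$ and $t$ with $0<t\le\mu\le(\log n)^{1+\xi}$ we have $$\mathbb{P}(X\ge\mu+t)\le C\exp\bigl(-c\,t^2/\operatorname{Var}X\bigr).$$ (iii) If $H$ is $2$-balanced, then there is $C=C(H)\ge 1$ such that for all $\sigma,\Lambda>0$ there is $c=c(\sigma,\Lambda,H)>0$ such that for all $n\ge v$, all $p\in[0,1]$ with $p\le\Lambda n^{-(v-2)/(e-1)-\sigma}$ and all $t$ with $0<t\le\Lambda\min\{(\mu\log n)^{1/(2-1/s)},\,\mu\}$ we have $$\mathbb{P}(X\ge\mu+t)\le C\exp\bigl(-c\,t^2/\mu\bigr).$$ -/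

import Mathlib

namespace SubgraphCount

/-- The density `d(J) = e_J / v_J` of a subgraph `J` of `H`; `d(H)` is the case `J = ⊤`. -/
noncomputable def density {V : Type*} {H : SimpleGraph V} (J : H.Subgraph) : ℝ :=
  (J.edgeSet.ncard : ℝ) / (J.verts.ncard : ℝ)

/-- The 2-density `d₂(J) = (e_J - 1) / (v_J - 2)` of a subgraph `J` of `H` (used for `v_J ≥ 3`). -/
noncomputable def density₂ {V : Type*} {H : SimpleGraph V} (J : H.Subgraph) : ℝ :=
  ((J.edgeSet.ncard : ℝ) - 1) / ((J.verts.ncard : ℝ) - 2)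

/-- `H` is strictly balanced: `e_H ≥ 1`, and `d(H) > d(J)` for all `J ⊊ H` with `v_J ≥ 1`. -/
def StrictlyBalanced {V : Type*} (H : SimpleGraph V) : Prop :=
  1 ≤ H.edgeSet.ncard ∧
    ∀ J : H.Subgraph, J ≠ ⊤ → 1 ≤ J.verts.ncard → density J < density (⊤ : H.Subgraph)

/-- `H` is 2-balanced: `e_H ≥ 2`, and `d₂(H) ≥ d₂(J)` for all `J ⊊ H` with `v_J ≥ 3`. -/
def TwoBalanced {V : Type*} (H : SimpleGraph V) : Prop :=
  2 ≤ H.edgeSet.ncard ∧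
    ∀ J : H.Subgraph, J ≠ ⊤ → 3 ≤ J.verts.ncard → density₂ J ≤ density₂ (⊤ : H.Subgraph)

/-- `s = min {v - 1, e - δ + 1}`, where `v`, `e`, `δ` are the number of vertices, the number of
edges and the minimum degree of `H`. (Always `δ ≤ e` for a graph with a vertex, so the
subtractions do not truncate.) -/
noncomputable def sParam {V : Type*} [Fintype V] (H : SimpleGraph V) [DecidableRel H.Adj] : ℕ :=
  min (Fintype.card V - 1) (H.edgeSet.ncard - H.minDegree + 1)

/-- The random variable `X = X_H` on graphs with vertex set `{0, …, n-1}`: the number of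
(unlabelled, not necessarily induced) copies of `H`. -/
noncomputable def X {V : Type*} (H : SimpleGraph V) (n : ℕ) (G : SimpleGraph (Fin n)) : ℝ :=
  (G.copyCount H : ℝ)

/-- The mean `μ = E X` in the binomial random graph `G(n,p)`. -/
noncomputable def mean {V : Type*} (H : SimpleGraph V) (n : ℕ) (p : unitInterval) : ℝ :=
  ∫ G, X H n G ∂(SimpleGraph.binomialRandom (Fin n) p)

/-- The variance `Var X` in `G(n,p)`. -/
noncomputable def var {V : Type*} (H : SimpleGraph V) (n : ℕ) (p : unitInterval) : ℝ :=
  ProbabilityTheory.variance (X H n) (SimpleGraph.binomialRandom (Fin n) p)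

/-- The upper tail probability `P(X ≥ x)` in `G(n,p)`. -/
noncomputable def upperTail {V : Type*} (H : SimpleGraph V) (n : ℕ) (p : unitInterval) (x : ℝ) :
    ℝ :=
  (SimpleGraph.binomialRandom (Fin n) p).real {G | x ≤ X H n G}

end SubgraphCount

/-! Let T be the family of edge sets of the copies of H that are present. If every member of T met
only boundedly many others, then #T ≥ μ + τ would force at least (μ + τ/2)^k tuples of k disjoint
members, for some k of order τ. The expected number of such tuples is at most μ^k, so Markov's
inequality gives exp(-cτ²/μ) (`prob_bounded_degree_le`).

Overlaps are controlled by sunflowers: copies that have an edge inside and an edge outside a small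
vertex set W, the core, and whose parts outside W, the petals, are pairwise disjoint. If no core
carries r petals, every edge lies in O(r^(s-1)) members: an Erdős–Rado type recursion enlarges a set
of edges until it spans a whole copy, and s bounds the number of steps (`card_filter_superset_le`).
This is used twice. If there is no sunflower with r petals and there are no r disjoint ones with k =
O(1) petals, then deleting all copies that meet a maximal disjoint collection of the latter costs
O(r^s) copies and leaves bounded degrees (`exists_bounded_degree`).

When the expected number of petals on each core is O(n^(-η)), a large constant k beats the
polynomial number of cores, and the exceptional events have probability at most 2 exp(-(η/4) r log
n). With r of order t^(1/s) the deleted copies number at most t/2, and this error is absorbed as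
soon as t²/μ = O(t^(1/s) log n) (`upperTail_le_of_edgesInside`). Either notion of balancedness
supplies the petal bound (the two lemmas `pow_mul_pow_le`), and the assumptions on ε or t give the
last inequality. Part (ii) follows from (i) because μ ≤ 2 Var X in its range. -/

namespace SubgraphCount

open Finset MeasureTheory

/-! ### Families of pairwise disjoint sets -/

section Disjoint

variable {ι E : Type*}

/-- The `k`-tuples of indices in `I` whose associated sets are pairwise disjoint. -/
noncomputable def disjTuples (I : Finset ι) (F : ι → Finset E) (k : ℕ) : Finset (Fin k → ι) :=
  open Classical in
  (Fintype.piFinset fun _ => I).filter fun f => Pairwise fun i j => Disjoint (F (f i)) (F (f j))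

theorem mem_disjTuples {I : Finset ι} {F : ι → Finset E} {k : ℕ} {f : Fin k → ι} :
    f ∈ disjTuples I F k ↔
      (∀ i, f i ∈ I) ∧ Pairwise fun i j => Disjoint (F (f i)) (F (f j)) := by
  simp [disjTuples]

theorem disjTuples_mono {I I' : Finset ι} (h : I ⊆ I') (F : ι → Finset E) (k : ℕ) :
    disjTuples I F k ⊆ disjTuples I' F k := fun f hf => by
  rw [mem_disjTuples] at hf ⊢
  exact ⟨fun i => h (hf.1 i), hf.2⟩

variable [DecidableEq E]

theorem cons_mem_disjTuples {I : Finset ι} {F : ι → Finset E} {k : ℕ} {a : ι} {f : Fin k → ι} :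
    Fin.cons (α := fun _ => ι) a f ∈ disjTuples I F (k + 1) ↔
      a ∈ I ∧ f ∈ disjTuples (I.filter fun i => Disjoint (F a) (F i)) F k := by
  rw [mem_disjTuples, mem_disjTuples, Fin.forall_fin_succ]
  simp only [Fin.cons_zero, Fin.cons_succ, mem_filter]
  constructor
  · rintro ⟨⟨ha, hf⟩, hd⟩
    refine ⟨ha, fun i => ⟨hf i, ?_⟩, fun i j hij => ?_⟩
    · simpa using hd (Fin.succ_ne_zero i).symm
    · simpa using hd (i := i.succ) (j := j.succ) (by simpa using hij)
  · rintro ⟨ha, hf, hd⟩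
    refine ⟨⟨ha, fun i => (hf i).1⟩, fun i j hij => ?_⟩
    induction i using Fin.cases with
    | zero =>
      induction j using Fin.cases with
      | zero => exact absurd rfl hij
      | succ j => simpa using (hf j).2
    | succ i =>
      induction j using Fin.cases with
      | zero => simpa using (hf i).2.symm
      | succ j => simpa using hd (i := i) (j := j) (by simpa using hij)

theorem card_disjTuples_succ (I : Finset ι) (F : ι → Finset E) (k : ℕ) :
    #(disjTuples I F (k + 1)) =
      ∑ a ∈ I, #(disjTuples (I.filter fun i => Disjoint (F a) (F i)) F k) := by
  rw [← card_sigma]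
  symm
  refine card_bij (fun x _ => Fin.cons x.1 x.2) ?_ ?_ ?_
  · rintro ⟨a, f⟩ h
    rw [mem_sigma] at h
    exact cons_mem_disjTuples.2 h
  · rintro ⟨a, f⟩ _ ⟨b, g⟩ _ h
    obtain ⟨rfl, rfl⟩ := Fin.cons_injective2 h
    rfl
  · intro f hf
    refine ⟨⟨f 0, Fin.tail f⟩, ?_, Fin.cons_self_tail f⟩
    rw [mem_sigma]
    exact cons_mem_disjTuples.1 (by rwa [Fin.cons_self_tail])

/-- If every member meets at most `D` members, there are many disjoint tuples. -/
theorem pow_le_card_disjTuples (F : ι → Finset E) {D L : ℝ} (hL : 0 ≤ L) (hD : 0 ≤ D) (k : ℕ) :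
    ∀ I : Finset ι, (∀ a ∈ I, (#(I.filter fun i => ¬ Disjoint (F a) (F i)) : ℝ) ≤ D) →
      L + k * D ≤ #I + D → L ^ k ≤ #(disjTuples I F k) := by
  induction k with
  | zero =>
    intro I _ _
    have : (fun i => Fin.elim0 i : Fin 0 → ι) ∈ disjTuples I F 0 := by
      rw [mem_disjTuples]
      exact ⟨fun i => Fin.elim0 i, fun i => Fin.elim0 i⟩
    rw [pow_zero]
    exact_mod_cast card_pos.2 ⟨_, this⟩
  -- The size hypothesis says L + (k - 1)D ≤ #I without a subtraction. A first choice excludes at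
  -- most D indices, so the hypothesis passes to the survivors and every choice has at least L
  -- options.
  | succ k ih =>
    intro I hI hc
    push_cast at hc
    have hk : 0 ≤ (k : ℝ) * D := by positivity
    rw [card_disjTuples_succ, Nat.cast_sum]
    calc L ^ (k + 1) = L * L ^ k := pow_succ' _ _
      _ ≤ #I * L ^ k := by gcongr; linarith
      _ = ∑ a ∈ I, L ^ k := by rw [sum_const, nsmul_eq_mul]
      _ ≤ _ := sum_le_sum fun a ha => by
        refine ih _ (fun b hb => ?_) ?_
        · refine le_trans ?_ (hI b (mem_filter.1 hb).1)
          exact_mod_cast card_le_card (filter_subset_filter _ (filter_subset _ _))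
        · have h1 := card_filter_add_card_filter_not (s := I) (fun i => Disjoint (F a) (F i))
          have h2 := hI a ha
          have h3 : (#(I.filter fun i => Disjoint (F a) (F i)) : ℝ) +
            #(I.filter fun i => ¬ Disjoint (F a) (F i)) = #I := by exact_mod_cast h1
          linarith

/-- If there are no `r` disjoint sets in a family, then all its members meet a small set. -/
theorem exists_cover {I : Finset ι} {F : ι → Finset E} {r b : ℕ}
    (h : disjTuples I F r = ∅) (hb : ∀ i ∈ I, #(F i) ≤ b) :
    ∃ U : Finset E, (∀ y ∈ U, ∃ i ∈ I, y ∈ F i) ∧ #U ≤ r * b ∧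
      ∀ i ∈ I, ¬ Disjoint (F i) U := by
  classical
  -- If k + 1 is the least length without disjoint tuples, a disjoint k-tuple cannot be extended, so
  -- its union meets every member.
  have hex : ∃ k, disjTuples I F k = ∅ := ⟨r, h⟩
  have h0 : (Nat.find hex) ≠ 0 := by
    intro h0
    have := Nat.find_spec hex
    rw [h0] at this
    have h1 : (fun i => Fin.elim0 i : Fin 0 → ι) ∈ disjTuples I F 0 := by
      rw [mem_disjTuples]
      exact ⟨fun i => Fin.elim0 i, fun i => Fin.elim0 i⟩
    rw [this] at h1
    exact absurd h1 (notMem_empty _)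
  obtain ⟨k, hk⟩ := Nat.exists_eq_succ_of_ne_zero h0
  have hkr : k + 1 ≤ r := by
    have := Nat.find_min' hex h
    omega
  have hne : disjTuples I F k ≠ ∅ := Nat.find_min hex (by omega)
  obtain ⟨f, hf⟩ := nonempty_iff_ne_empty.2 hne
  have hf' := mem_disjTuples.1 hf
  refine ⟨univ.biUnion fun i => F (f i), ?_, ?_, fun a ha hd => ?_⟩
  · intro y hy
    obtain ⟨i, -, hi⟩ := mem_biUnion.1 hy
    exact ⟨f i, hf'.1 i, hi⟩
  · calc _ ≤ ∑ i : Fin k, #(F (f i)) := card_biUnion_le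
      _ ≤ ∑ i : Fin k, b := sum_le_sum fun i _ => hb _ (hf'.1 i)
      _ = k * b := by simp
      _ ≤ r * b := Nat.mul_le_mul_right _ (by omega)
  · have hm : Fin.cons (α := fun _ => ι) a f ∈ disjTuples I F (k + 1) := by
      rw [cons_mem_disjTuples]
      refine ⟨ha, mem_disjTuples.2 ⟨fun i => mem_filter.2 ⟨hf'.1 i, ?_⟩, hf'.2⟩⟩
      exact (disjoint_biUnion_right _ _ _).1 hd i (mem_univ i)
    have := Nat.find_spec hex
    rw [hk] at this
    rw [Nat.succ_eq_add_one] at this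
    rw [this] at hm
    exact absurd hm (notMem_empty _)

/-- Disjointness turns the weight of a union into a product; dropping the disjointness then leaves
the full expansion of the k-th power. -/
theorem sum_disjTuples_le (I : Finset ι) (F : ι → Finset E) {p : ℝ} (hp : 0 ≤ p) (k : ℕ) :
    ∑ f ∈ disjTuples I F k, p ^ #(univ.biUnion fun i => F (f i)) ≤
      (∑ i ∈ I, p ^ #(F i)) ^ k := by
  calc _ = ∑ f ∈ disjTuples I F k, ∏ i, p ^ #(F (f i)) := by
        refine sum_congr rfl fun f hf => ?_
        rw [card_biUnion (fun i _ j _ hij => (mem_disjTuples.1 hf).2 hij), prod_pow_eq_pow_sum]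
    _ ≤ ∑ f ∈ Fintype.piFinset fun _ : Fin k => I, ∏ i, p ^ #(F (f i)) :=
        sum_le_sum_of_subset_of_nonneg (fun f hf => Fintype.mem_piFinset.2 (mem_disjTuples.1 hf).1)
          fun _ _ _ => by positivity
    _ = _ := by
        rw [← prod_univ_sum (fun _ : Fin k => I) (fun _ i => p ^ #(F i))]
        simp

end Disjoint

/-! ### Union bounds for random sets -/

section Random

variable {Ω ι E : Type*} [Finite Ω] [MeasurableSpace Ω] [MeasurableSingletonClass Ω]
  [DecidableEq E] (P : Measure Ω) [IsProbabilityMeasure P]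

/-- Markov's inequality for the number of members contained in S. An upper bound on containment
probabilities is enough, so sets with loops need not be excluded later. -/
theorem prob_le_card_filter {S : Ω → Finset E} {p : ℝ}
    (hS : ∀ F : Finset E, P.real {ω | F ⊆ S ω} ≤ p ^ #F) (I : Finset ι) (F : ι → Finset E)
    {a : ℝ} (ha : 0 < a) :
    P.real {ω | a ≤ #(I.filter fun i => F i ⊆ S ω)} ≤ (∑ i ∈ I, p ^ #(F i)) / a := by
  have hm : ∀ s : Set Ω, MeasurableSet s := fun s => s.toFinite.measurableSet
  have h1 := mul_meas_ge_le_integral_of_nonneg (μ := P)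
    (f := fun ω => (#(I.filter fun i => F i ⊆ S ω) : ℝ))
    (Filter.Eventually.of_forall fun ω => Nat.cast_nonneg _) Integrable.of_finite a
  have h2 : ∫ ω, (#(I.filter fun i => F i ⊆ S ω) : ℝ) ∂P ≤ ∑ i ∈ I, p ^ #(F i) := by
    have : ∀ ω, (#(I.filter fun i => F i ⊆ S ω) : ℝ) =
        ∑ i ∈ I, {ω | F i ⊆ S ω}.indicator (fun _ => (1 : ℝ)) ω := fun ω => by
      rw [card_filter]
      push_cast
      exact sum_congr rfl fun i _ => by simp [Set.indicator_apply]
    simp_rw [this]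
    rw [integral_finsetSum _ fun _ _ => Integrable.of_finite]
    refine sum_le_sum fun i _ => ?_
    rw [integral_indicator_const _ (hm _)]
    simpa using hS (F i)
  rw [le_div_iff₀ ha, mul_comm]
  exact h1.trans h2

theorem prob_exists_le {S : Ω → Finset E} {p : ℝ}
    (hS : ∀ F : Finset E, P.real {ω | F ⊆ S ω} ≤ p ^ #F) (I : Finset ι) (F : ι → Finset E) :
    P.real {ω | ∃ i ∈ I, F i ⊆ S ω} ≤ ∑ i ∈ I, p ^ #(F i) := by
  have := prob_le_card_filter P hS I F one_pos
  rw [div_one] at this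
  refine le_trans (measureReal_mono ?_) this
  rintro ω ⟨i, hi, h⟩
  simp only [Set.mem_ofPred_eq, Nat.one_le_cast]
  exact card_pos.2 ⟨i, mem_filter.2 ⟨hi, h⟩⟩

/-- The probability that a random set contains `r` disjoint sets of a given family. -/
theorem prob_disjTuples_le {S : Ω → Finset E} {p : ℝ} (hp : 0 ≤ p)
    (hS : ∀ F : Finset E, P.real {ω | F ⊆ S ω} ≤ p ^ #F) (I : Finset ι) (F : ι → Finset E)
    (r : ℕ) :
    P.real {ω | (disjTuples (I.filter fun i => F i ⊆ S ω) F r).Nonempty} ≤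
      (∑ i ∈ I, p ^ #(F i)) ^ r := by
  refine le_trans (measureReal_mono ?_) ((prob_exists_le P hS (disjTuples I F r)
    (fun f => univ.biUnion fun i => F (f i))).trans (sum_disjTuples_le I F hp r))
  rintro ω ⟨f, hf⟩
  refine ⟨f, disjTuples_mono (filter_subset _ _) _ _ hf, ?_⟩
  refine biUnion_subset.2 fun i _ => ?_
  exact (mem_filter.1 ((mem_disjTuples.1 hf).1 i)).2

/-- Chernoff-type upper tail for subfamilies in which every member meets few others. -/
theorem prob_bounded_degree_le {S : Ω → Finset E} {p : ℝ} (hp : 0 ≤ p)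
    (hS : ∀ F : Finset E, P.real {ω | F ⊆ S ω} ≤ p ^ #F) (A : Finset (Finset E))
    {m D Λ τ : ℝ} (hm : m = ∑ a ∈ A, p ^ #a) (hm0 : 0 < m) (hD : 0 < D) (hτ : 0 < τ)
    (hΛ : τ ≤ Λ * m) :
    P.real {ω | ∃ T ⊆ A, (∀ a ∈ T, a ⊆ S ω) ∧
        (∀ a ∈ T, (#(T.filter fun b => ¬ Disjoint a b) : ℝ) ≤ D) ∧ m + τ ≤ #T} ≤
      Real.exp (-(τ ^ 2 / (4 * D * ((1 + Λ) * m)))) := by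
  -- Here (k - 1)D ≤ τ/2, so L = m + τ/2 options remain at each of the k choices, while k ≥ τ/(2D)
  -- makes (m/L)^k exponentially small.
  set k : ℕ := ⌊τ / (2 * D)⌋₊ + 1 with hk
  set L : ℝ := m + τ / 2 with hL
  have hL0 : 0 < L := by positivity
  have hk1 : τ / (2 * D) ≤ k := by
    rw [hk]; push_cast; exact (Nat.lt_floor_add_one _).le
  have hk2 : (k : ℝ) * D ≤ τ / 2 + D := by
    have : (⌊τ / (2 * D)⌋₊ : ℝ) ≤ τ / (2 * D) := Nat.floor_le (by positivity)
    rw [hk]; push_cast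
    have h2 : (⌊τ / (2 * D)⌋₊ : ℝ) * D ≤ τ / (2 * D) * D := by gcongr
    have h3 : τ / (2 * D) * D = τ / 2 := by field_simp
    linarith
  have h1 := prob_le_card_filter P hS (disjTuples A id k)
    (fun f => univ.biUnion fun i => f i) (a := L ^ k) (by positivity)
  have h2 := sum_disjTuples_le A id hp k
  simp only [id] at h2
  rw [← hm] at h2
  refine le_trans (measureReal_mono ?_) (h1.trans ?_)
  · rintro ω ⟨T, hTA, hTS, hTD, hTm⟩
    have h3 := pow_le_card_disjTuples (id : Finset E → Finset E) hL0.le hD.le k T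
      (by simpa using hTD) (by linarith)
    refine h3.trans ?_
    have h4 : disjTuples T id k ⊆ (disjTuples A id k).filter
        (fun f => (univ.biUnion fun i => f i) ⊆ S ω) := fun f hf => by
      refine mem_filter.2 ⟨disjTuples_mono hTA _ _ hf, biUnion_subset.2 fun i _ => ?_⟩
      exact hTS _ ((mem_disjTuples.1 hf).1 i)
    exact_mod_cast card_le_card h4
  · calc _ ≤ m ^ k / L ^ k := by gcongr
      _ = (m / L) ^ k := by rw [div_pow]
      _ ≤ (Real.exp (-(τ / 2 / L))) ^ k := by
          gcongr
          have : m / L = -(τ / 2 / L) + 1 := by field_simp; rw [hL]; ring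
          rw [this]
          exact Real.add_one_le_exp _
      _ = Real.exp (-(k * (τ / 2 / L))) := by rw [← Real.exp_nat_mul]; ring_nf
      _ ≤ _ := by
          rw [Real.exp_le_exp, neg_le_neg_iff]
          calc τ ^ 2 / (4 * D * ((1 + Λ) * m)) ≤ τ ^ 2 / (4 * D * L) := by
                gcongr; rw [hL]; linarith
            _ = τ / (2 * D) * (τ / 2 / L) := by field_simp; norm_num
            _ ≤ _ := by gcongr

end Random

/-! ### Sunflowers of copies -/

section Sunflower

variable {α : Type*} [DecidableEq α]

/-- The vertices covered by a set of edges. -/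
def spanned (J : Finset (Sym2 α)) : Finset α := J.biUnion Sym2.toFinset

theorem mem_spanned {J : Finset (Sym2 α)} {x : α} : x ∈ spanned J ↔ ∃ y ∈ J, x ∈ y := by
  simp [spanned]

theorem spanned_mono {J J' : Finset (Sym2 α)} (h : J ⊆ J') : spanned J ⊆ spanned J' :=
  biUnion_subset_biUnion_of_subset_left _ h

theorem subset_sym2_iff {J : Finset (Sym2 α)} {W : Finset α} :
    J ⊆ W.sym2 ↔ spanned J ⊆ W := by
  simp only [subset_iff, mem_spanned, mem_sym2_iff]
  exact ⟨fun h x ⟨y, hy, hx⟩ => h hy x hx, fun h y hy x hx => h ⟨y, hy, hx⟩⟩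

/-- The members of a family that have an edge inside the core `W` and an edge not inside it. -/
def cored (T : Finset (Finset (Sym2 α))) (W : Finset α) : Finset (Finset (Sym2 α)) :=
  T.filter fun A => (A ∩ W.sym2).Nonempty ∧ ¬ A ⊆ W.sym2

/-- The part of an edge set outside the core `W`. -/
def petal (W : Finset α) (A : Finset (Sym2 α)) : Finset (Sym2 α) := A \ W.sym2

/-- Let W be the span of J. Few members lie inside W. The others are cored at W, and since no r
petals are disjoint, at most re edges hit all their petals. Adding such an edge to J raises both the
edge count and the vertex count, so j counts the steps left until J has s edges and s + 1 vertices;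
from then on any member containing J lies inside W. -/
theorem card_filter_superset_le {T : Finset (Finset (Sym2 α))} {s e v r : ℕ}
    (he : ∀ A ∈ T, #A ≤ e) (hv : ∀ A ∈ T, #(spanned A) ≤ v)
    (hs : ∀ A ∈ T, ∀ J ⊆ A, s ≤ #J → s + 1 ≤ #(spanned J) → spanned J = spanned A)
    (hr : ∀ W : Finset α, #W ≤ v → disjTuples (cored T W) (petal W) r = ∅) (j : ℕ) :
    ∀ J : Finset (Sym2 α), J.Nonempty → s ≤ #J + j → s + 1 ≤ #(spanned J) + j →
      #(T.filter fun A => J ⊆ A) ≤ 2 ^ (v + 1).choose 2 * (1 + r * e) ^ j := by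
  have key : ∀ W : Finset α, #W ≤ v →
      #(T.filter fun A => A ⊆ W.sym2) ≤ 2 ^ (v + 1).choose 2 := fun W hW => by
    calc _ ≤ #(W.sym2.powerset) := card_le_card fun A hA => mem_powerset.2 (mem_filter.1 hA).2
      _ = 2 ^ (#W + 1).choose 2 := by rw [card_powerset, card_sym2]
      _ ≤ _ := Nat.pow_le_pow_right two_pos (Nat.choose_le_choose 2 (by omega))
  induction j with
  | zero =>
    intro J hJ h1 h2
    rcases (T.filter fun A => J ⊆ A).eq_empty_or_nonempty with h | ⟨A, hA⟩
    · simp [h]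
    rw [mem_filter] at hA
    have hJv : #(spanned J) ≤ v := (card_le_card (spanned_mono hA.2)).trans (hv A hA.1)
    rw [pow_zero, mul_one]
    refine le_trans (card_le_card fun B hB => ?_) (key _ hJv)
    rw [mem_filter] at hB ⊢
    refine ⟨hB.1, subset_sym2_iff.2 ?_⟩
    rw [hs B hB.1 J hB.2 (by simpa using h1) (by simpa using h2)]
  | succ j ih =>
    intro J hJ h1 h2
    rcases (T.filter fun A => J ⊆ A).eq_empty_or_nonempty with h | ⟨A, hA⟩
    · simp [h]
    rw [mem_filter] at hA
    set W := spanned J with hW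
    have hJv : #W ≤ v := (card_le_card (spanned_mono hA.2)).trans (hv A hA.1)
    have hJW : J ⊆ W.sym2 := subset_sym2_iff.2 subset_rfl
    set I := (T.filter fun A => J ⊆ A).filter fun A => ¬ A ⊆ W.sym2 with hI
    have hIc : I ⊆ cored T W := fun B hB => by
      simp only [hI, mem_filter] at hB
      obtain ⟨y, hy⟩ := hJ
      exact mem_filter.2 ⟨hB.1.1, ⟨y, mem_inter.2 ⟨hB.1.2 hy, hJW hy⟩⟩, hB.2⟩
    have hIe : disjTuples I (petal W) r = ∅ :=
      subset_empty.1 ((disjTuples_mono hIc _ _).trans (hr W hJv).subset)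
    obtain ⟨U, hU1, hU2, hU3⟩ := exists_cover (b := e) hIe fun B hB =>
      (card_le_card sdiff_subset).trans (he B (mem_filter.1 (mem_filter.1 hB).1).1)
    have hsub : (T.filter fun A => J ⊆ A) ⊆ (T.filter fun A => A ⊆ W.sym2) ∪
        U.biUnion fun y => T.filter fun A => insert y J ⊆ A := fun B hB => by
      rw [mem_union]
      by_cases hBW : B ⊆ W.sym2
      · exact Or.inl (mem_filter.2 ⟨(mem_filter.1 hB).1, hBW⟩)
      · right
        obtain ⟨y, hy, hyU⟩ := not_disjoint_iff.1 (hU3 B (mem_filter.2 ⟨hB, hBW⟩))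
        exact mem_biUnion.2 ⟨y, hyU, mem_filter.2 ⟨(mem_filter.1 hB).1,
          insert_subset (mem_sdiff.1 hy).1 (mem_filter.1 hB).2⟩⟩
    calc _ ≤ 2 ^ (v + 1).choose 2 + ∑ y ∈ U, #(T.filter fun A => insert y J ⊆ A) :=
          (card_le_card hsub).trans ((card_union_le _ _).trans
            (add_le_add (key W hJv) card_biUnion_le))
      _ ≤ 2 ^ (v + 1).choose 2 + ∑ y ∈ U, 2 ^ (v + 1).choose 2 * (1 + r * e) ^ j := by
          refine Nat.add_le_add_left (sum_le_sum fun y hy => ?_) _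
          obtain ⟨B, hB, hyB⟩ := hU1 y hy
          have hyW : y ∉ W.sym2 := (mem_sdiff.1 hyB).2
          -- The new edge has an endpoint outside W, so the span really grows.
          obtain ⟨x, hxy, hxW⟩ : ∃ x ∈ y, x ∉ W := by
            by_contra hc
            push Not at hc
            exact hyW (mem_sym2_iff.2 hc)
          refine ih _ (insert_nonempty _ _) ?_ ?_
          · rw [card_insert_of_notMem fun h => hyW (hJW h)]
            omega
          · have : insert x W ⊆ spanned (insert y J) := insert_subset
              (mem_spanned.2 ⟨y, mem_insert_self _ _, hxy⟩) (spanned_mono (subset_insert _ _))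
            have h3 := card_le_card this
            rw [card_insert_of_notMem hxW] at h3
            omega
      _ ≤ 2 ^ (v + 1).choose 2 * (1 + r * e) ^ j +
          (r * e) * (2 ^ (v + 1).choose 2 * (1 + r * e) ^ j) := by
          rw [sum_const, smul_eq_mul]
          gcongr
          exact Nat.le_mul_of_pos_right _ (by positivity)
      _ = _ := by ring

/-- If a family has no sunflower with `r` petals, every edge lies in few of its members. -/
theorem card_filter_mem_le {T : Finset (Finset (Sym2 α))} {s e v r : ℕ} (hs0 : 1 ≤ s)
    (hdiag : ∀ A ∈ T, ∀ y ∈ A, ¬ y.IsDiag)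
    (he : ∀ A ∈ T, #A ≤ e) (hv : ∀ A ∈ T, #(spanned A) ≤ v)
    (hs : ∀ A ∈ T, ∀ J ⊆ A, s ≤ #J → s + 1 ≤ #(spanned J) → spanned J = spanned A)
    (hr : ∀ W : Finset α, #W ≤ v → disjTuples (cored T W) (petal W) r = ∅) (y : Sym2 α) :
    #(T.filter fun A => y ∈ A) ≤ 2 ^ (v + 1).choose 2 * (1 + r * e) ^ (s - 1) := by
  rcases (T.filter fun A => y ∈ A).eq_empty_or_nonempty with h | ⟨A, hA⟩
  · simp [h]
  rw [mem_filter] at hA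
  have h2 : #(spanned {y}) = 2 := by
    rw [spanned, singleton_biUnion]
    exact Sym2.card_toFinset_of_not_isDiag y (hdiag A hA.1 y hA.2)
  -- A single edge has 1 edge and 2 vertices, hence s - 1 steps to reach s and s + 1.
  have := card_filter_superset_le he hv hs hr (s - 1) {y} (singleton_nonempty y)
    (by rw [card_singleton]; omega) (by omega)
  simpa using this

/-- If a family has no sunflower with `r` petals, every member meets few others. -/
theorem card_filter_not_disjoint_le {T : Finset (Finset (Sym2 α))} {s e v r : ℕ} (hs0 : 1 ≤ s)
    (hdiag : ∀ A ∈ T, ∀ y ∈ A, ¬ y.IsDiag)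
    (he : ∀ A ∈ T, #A ≤ e) (hv : ∀ A ∈ T, #(spanned A) ≤ v)
    (hs : ∀ A ∈ T, ∀ J ⊆ A, s ≤ #J → s + 1 ≤ #(spanned J) → spanned J = spanned A)
    (hr : ∀ W : Finset α, #W ≤ v → disjTuples (cored T W) (petal W) r = ∅)
    (U : Finset (Sym2 α)) :
    #(T.filter fun A => ¬ Disjoint U A) ≤
      #U * (2 ^ (v + 1).choose 2 * (1 + r * e) ^ (s - 1)) := by
  calc _ ≤ #(U.biUnion fun y => T.filter fun A => y ∈ A) := by
        refine card_le_card fun A hA => ?_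
        rw [mem_filter] at hA
        obtain ⟨y, hy, hyA⟩ := not_disjoint_iff.1 hA.2
        exact mem_biUnion.2 ⟨y, hy, mem_filter.2 ⟨hA.1, hyA⟩⟩
    _ ≤ #U * _ := card_biUnion_le_card_mul _ _ _ fun y _ =>
        card_filter_mem_le hs0 hdiag he hv hs hr y

end Sunflower

/-! ### The upper tail in terms of sunflowers -/

section UpperTail

variable {α : Type*} [DecidableEq α]

theorem cored_mono {T T' : Finset (Finset (Sym2 α))} (h : T ⊆ T') (W : Finset α) :
    cored T W ⊆ cored T' W := filter_subset_filter _ h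

/-- Outside the exceptional event that the family contains a large sunflower or many disjoint
small sunflowers, a large subfamily has bounded degrees. -/
theorem exists_bounded_degree {T : Finset (Finset (Sym2 α))} {s e v r k : ℕ} (hs0 : 1 ≤ s)
    (hdiag : ∀ A ∈ T, ∀ y ∈ A, ¬ y.IsDiag)
    (he : ∀ A ∈ T, #A ≤ e) (hv : ∀ A ∈ T, #(spanned A) ≤ v)
    (hs : ∀ A ∈ T, ∀ J ⊆ A, s ≤ #J → s + 1 ≤ #(spanned J) → spanned J = spanned A)
    (hr : ∀ W : Finset α, #W ≤ v → disjTuples (cored T W) (petal W) r = ∅)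
    {I : Finset (Σ _ : Finset α, Fin k → Finset (Sym2 α))}
    (hI : ∀ i, i ∈ I ↔ #i.1 ≤ v ∧ i.2 ∈ disjTuples (cored T i.1) (petal i.1) k)
    (hk : disjTuples I (fun i => univ.biUnion fun j => petal i.1 (i.2 j)) r = ∅) :
    ∃ T' ⊆ T, (∀ a ∈ T', #(T'.filter fun b => ¬ Disjoint a b) ≤
        e * (2 ^ (v + 1).choose 2 * (1 + k * e) ^ (s - 1))) ∧
      #T ≤ #T' + r * (k * e) * (2 ^ (v + 1).choose 2 * (1 + r * e) ^ (s - 1)) := by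
  obtain ⟨U, -, hU2, hU3⟩ := exists_cover (b := k * e) hk fun i hi => by
    have h1 := mem_disjTuples.1 ((hI i).1 hi).2
    calc _ ≤ ∑ j : Fin k, #(petal i.1 (i.2 j)) := card_biUnion_le
      _ ≤ ∑ j : Fin k, e := sum_le_sum fun j _ =>
        (card_le_card sdiff_subset).trans (he _ (mem_filter.1 (h1.1 j)).1)
      _ = k * e := by simp
  set T' := T.filter fun A => Disjoint U A with hT'
  have hTT : T' ⊆ T := filter_subset _ _
  refine ⟨T', hTT, fun a ha => ?_, ?_⟩
  · refine (card_filter_not_disjoint_le hs0 (fun A hA => hdiag A (hTT hA))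
      (fun A hA => he A (hTT hA)) (fun A hA => hv A (hTT hA)) (fun A hA => hs A (hTT hA))
      (r := k) (fun W hW => ?_) a).trans (Nat.mul_le_mul_right _ (he a (hTT ha)))
    -- A sunflower with k petals inside `T'` would have to meet U, yet its petals lie in copies
    -- disjoint from U.
    by_contra hne
    obtain ⟨f, hf⟩ := nonempty_iff_ne_empty.2 hne
    refine hU3 ⟨W, f⟩ ((hI _).2 ⟨hW, disjTuples_mono (cored_mono hTT W) _ _ hf⟩) ?_
    refine (disjoint_biUnion_left _ _ _).2 fun j _ => ?_
    have h1 := (mem_filter.1 (mem_filter.1 ((mem_disjTuples.1 hf).1 j)).1).2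
    exact h1.symm.mono_left sdiff_subset
  · have h1 : #T' + #(T.filter fun A => ¬ Disjoint U A) = #T :=
      card_filter_add_card_filter_not _
    have h2 := card_filter_not_disjoint_le hs0 hdiag he hv hs hr U
    have h3 : #U * (2 ^ (v + 1).choose 2 * (1 + r * e) ^ (s - 1)) ≤
      r * (k * e) * (2 ^ (v + 1).choose 2 * (1 + r * e) ^ (s - 1)) :=
      Nat.mul_le_mul_right _ hU2
    omega

variable {Ω : Type*} [Finite Ω] [MeasurableSpace Ω] [MeasurableSingletonClass Ω]
  (P : Measure Ω) [IsProbabilityMeasure P] [Fintype α]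

/-- The three terms bound three events: a large subfamily of bounded degree, a core with r disjoint
petals, and r disjoint sunflowers with k petals each. The excess 2τ is split: τ pays for the deleted
copies, and the other τ is the deviation of the subfamily. -/
theorem prob_upper_tail_le {S : Ω → Finset (Sym2 α)} {p : ℝ} (hp : 0 ≤ p)
    (hS : ∀ F : Finset (Sym2 α), P.real {ω | F ⊆ S ω} ≤ p ^ #F)
    (A : Finset (Finset (Sym2 α))) {s e v r k : ℕ} (hs0 : 1 ≤ s) (he0 : 1 ≤ e)
    (hdiag : ∀ a ∈ A, ∀ y ∈ a, ¬ y.IsDiag)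
    (he : ∀ a ∈ A, #a ≤ e) (hv : ∀ a ∈ A, #(spanned a) ≤ v)
    (hs : ∀ a ∈ A, ∀ J ⊆ a, s ≤ #J → s + 1 ≤ #(spanned J) → spanned J = spanned a)
    {q : ℝ}
    (hq : ∀ W : Finset α, #W ≤ v → ∑ a ∈ cored A W, p ^ #(petal W a) ≤ q)
    {m Λ τ : ℝ} (hm : m = ∑ a ∈ A, p ^ #a) (hm0 : 0 < m) (hτ : 0 < τ) (hΛ : τ ≤ Λ * m)
    (hrτ : (r * (k * e) * (2 ^ (v + 1).choose 2 * (1 + r * e) ^ (s - 1)) : ℝ) ≤ τ) :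
    P.real {ω | m + 2 * τ ≤ #(A.filter fun a => a ⊆ S ω)} ≤
      Real.exp (-(τ ^ 2 / (4 * (e * (2 ^ (v + 1).choose 2 * (1 + k * e) ^ (s - 1))) *
        ((1 + Λ) * m)))) +
      (#((univ : Finset (Finset α)).filter fun W => #W ≤ v) * q ^ r +
      (#((univ : Finset (Finset α)).filter fun W => #W ≤ v) * q ^ k) ^ r) := by
  set cores := (univ : Finset (Finset α)).filter fun W => #W ≤ v with hcores
  have hcq : ∀ (l : ℕ), ∀ W ∈ cores, (∑ a ∈ cored A W, p ^ #(petal W a)) ^ l ≤ q ^ l :=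
    fun l W hW => pow_le_pow_left₀ (sum_nonneg fun _ _ => by positivity)
      (hq W (mem_filter.1 hW).2) l
  have hD : (0 : ℝ) < e * (2 ^ (v + 1).choose 2 * (1 + k * e) ^ (s - 1)) := by
    have : (0 : ℝ) < e := by exact_mod_cast he0
    positivity
  set I := cores.sigma fun W => disjTuples (cored A W) (petal W) k with hI
  set F : (Σ _ : Finset α, Fin k → Finset (Sym2 α)) → Finset (Sym2 α) :=
    fun i => univ.biUnion fun j => petal i.1 (i.2 j) with hF
  have h1 := prob_bounded_degree_le P hp hS A hm hm0 hD hτ hΛ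
  have h2 : P.real (⋃ W ∈ cores, {ω | (disjTuples ((cored A W).filter fun a => petal W a ⊆ S ω)
      (petal W) r).Nonempty}) ≤ #cores * q ^ r := by
    refine (measureReal_biUnion_finset_le _ _).trans ?_
    rw [← nsmul_eq_mul]
    exact sum_le_card_nsmul _ _ _ fun W hW =>
      (prob_disjTuples_le P hp hS _ _ r).trans (hcq r W hW)
  have h3 : P.real {ω | (disjTuples (I.filter fun i => F i ⊆ S ω) F r).Nonempty} ≤
      (#cores * q ^ k) ^ r := by
    refine (prob_disjTuples_le P hp hS I F r).trans
      (pow_le_pow_left₀ (sum_nonneg fun _ _ => by positivity) ?_ r)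
    rw [hI, sum_sigma, ← nsmul_eq_mul]
    exact sum_le_card_nsmul _ _ _ fun W hW =>
      (sum_disjTuples_le (cored A W) (petal W) hp k).trans (hcq k W hW)
  refine le_trans (measureReal_mono (fun ω hω => ?_)) ((measureReal_union_le _ _).trans
    (add_le_add h1 ((measureReal_union_le _ _).trans (add_le_add h2 h3))))
  by_contra hc
  simp only [Set.mem_union, not_or] at hc
  obtain ⟨c1, c2, c3⟩ := hc
  set T := A.filter fun a => a ⊆ S ω with hT
  have hTA : T ⊆ A := filter_subset _ _
  -- Only the presence of the petals is used; dropping the core edges gives an event that is bounded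
  -- by independent petals.
  have hTc : ∀ W, cored T W ⊆ (cored A W).filter fun a => petal W a ⊆ S ω := fun W a ha =>
    mem_filter.2 ⟨cored_mono hTA W ha,
      sdiff_subset.trans (mem_filter.1 (mem_filter.1 ha).1).2⟩
  obtain ⟨T', hT', hd, hcard⟩ := exists_bounded_degree (T := T) (r := r) (k := k) hs0
    (fun a ha => hdiag a (hTA ha)) (fun a ha => he a (hTA ha)) (fun a ha => hv a (hTA ha))
    (fun a ha => hs a (hTA ha))
    (fun W hW => by
      by_contra hne
      refine c2 (Set.mem_biUnion (mem_filter.2 ⟨mem_univ W, hW⟩) ?_)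
      exact (nonempty_iff_ne_empty.2 hne).mono (disjTuples_mono (hTc W) _ _))
    (I := cores.sigma fun W => disjTuples (cored T W) (petal W) k)
    (fun i => by simp [hcores])
    (by
      by_contra hne
      refine c3 ((nonempty_iff_ne_empty.2 hne).mono (disjTuples_mono (fun i hi => ?_) _ _))
      rw [mem_sigma] at hi
      refine mem_filter.2 ⟨mem_sigma.2 ⟨hi.1, disjTuples_mono (cored_mono hTA _) _ _ hi.2⟩, ?_⟩
      refine biUnion_subset.2 fun j _ => ?_
      exact (mem_filter.1 (hTc i.1 ((mem_disjTuples.1 hi.2).1 j))).2)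
  refine c1 ⟨T', hT'.trans hTA, fun a ha => (mem_filter.1 (hT' ha)).2,
    fun a ha => by exact_mod_cast hd a ha, ?_⟩
  have h4 : (#T : ℝ) ≤ #T' + r * (k * e) * (2 ^ (v + 1).choose 2 * (1 + r * e) ^ (s - 1)) := by
    exact_mod_cast hcard
  have h5 : m + 2 * τ ≤ #T := hω
  linarith

end UpperTail

/-! ### Copies of a graph as edge sets -/

section Copies

variable {V : Type*} [Fintype V] (H : SimpleGraph V) [DecidableRel H.Adj] (n : ℕ)

/-- The edge set of the copy of `H` given by an injection of the vertices. -/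
def edgesOf {n : ℕ} (φ : V ↪ Fin n) : Finset (Sym2 (Fin n)) := H.edgeFinset.map φ.sym2Map

/-- The edge sets of the copies of `H` in the complete graph on `n` vertices. -/
noncomputable def copies : Finset (Finset (Sym2 (Fin n))) := univ.image (edgesOf H)

variable {H n}

theorem mem_edgesOf {φ : V ↪ Fin n} {y : Sym2 (Fin n)} :
    y ∈ edgesOf H φ ↔ ∃ z ∈ H.edgeSet, Sym2.map φ z = y := by
  simp [edgesOf, Function.Embedding.sym2Map]

theorem mem_copies {A : Finset (Sym2 (Fin n))} : A ∈ copies H n ↔ ∃ φ, edgesOf H φ = A := by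
  simp [copies]

theorem card_edgesOf (φ : V ↪ Fin n) : #(edgesOf H φ) = #H.edgeFinset := card_map _

theorem not_isDiag_of_mem_copies {A : Finset (Sym2 (Fin n))} (hA : A ∈ copies H n)
    {y : Sym2 (Fin n)} (hy : y ∈ A) : ¬ y.IsDiag := by
  obtain ⟨φ, rfl⟩ := mem_copies.1 hA
  obtain ⟨z, hz, rfl⟩ := mem_edgesOf.1 hy
  rw [Sym2.isDiag_map φ.injective]
  exact H.not_isDiag_of_mem_edgeSet hz

theorem card_of_mem_copies {A : Finset (Sym2 (Fin n))} (hA : A ∈ copies H n) :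
    #A = #H.edgeFinset := by
  obtain ⟨φ, rfl⟩ := mem_copies.1 hA
  exact card_edgesOf φ

theorem spanned_edgesOf (hH : ∀ x, ∃ y, H.Adj x y) (φ : V ↪ Fin n) :
    spanned (edgesOf H φ) = univ.map φ := by
  ext x
  simp only [mem_spanned, mem_edgesOf, mem_map, mem_univ, true_and]
  constructor
  · rintro ⟨_, ⟨z, -, rfl⟩, hx⟩
    obtain ⟨a, -, rfl⟩ := Sym2.mem_map.1 hx
    exact ⟨a, rfl⟩
  · rintro ⟨a, rfl⟩
    obtain ⟨b, hb⟩ := hH a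
    exact ⟨_, ⟨s(a, b), hb, rfl⟩, by simp⟩

theorem card_spanned_of_mem_copies (hH : ∀ x, ∃ y, H.Adj x y) {A : Finset (Sym2 (Fin n))}
    (hA : A ∈ copies H n) : #(spanned A) = Fintype.card V := by
  obtain ⟨φ, rfl⟩ := mem_copies.1 hA
  rw [spanned_edgesOf hH, card_map, card_univ]

/-- Any `s` edges of a copy of `H` that span more than `s` vertices span all of its vertices. -/
theorem spanned_eq_of_sParam_le (hH : ∀ x, ∃ y, H.Adj x y) {A J : Finset (Sym2 (Fin n))}
    (hA : A ∈ copies H n) (hJ : J ⊆ A) (h1 : sParam H ≤ #J)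
    (h2 : sParam H + 1 ≤ #(spanned J)) : spanned J = spanned A := by
  classical
  have hcard := card_spanned_of_mem_copies hH hA
  have hsub := spanned_mono hJ
  rcases min_choice (Fintype.card V - 1) (H.edgeSet.ncard - H.minDegree + 1) with h | h
  -- If s = v - 1, then J spans at least v vertices, which is all of them.
  · rw [sParam, h] at h2
    exact eq_of_subset_of_card_le hsub (by omega)
  · rw [sParam, h, ← SimpleGraph.coe_edgeFinset, Set.ncard_coe_finset] at h1
    obtain ⟨φ, rfl⟩ := mem_copies.1 hA
    refine subset_antisymm hsub fun x hx => ?_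
    rw [spanned_edgesOf hH, mem_map] at hx
    obtain ⟨a, -, rfl⟩ := hx
    by_contra hc
    -- If s = e - δ + 1 and J missed a vertex, J would fit into the at most e - δ edges avoiding it.
    have hJ' : J ⊆ (H.edgeFinset \ H.incidenceFinset a).map φ.sym2Map := fun y hy => by
      obtain ⟨z, hz, rfl⟩ := mem_edgesOf.1 (hJ hy)
      refine mem_map.2 ⟨z, mem_sdiff.2 ⟨by simpa using hz, fun hza => ?_⟩, rfl⟩
      refine hc (mem_spanned.2 ⟨_, hy, Sym2.mem_map.2 ⟨a, ?_, rfl⟩⟩)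
      simp only [SimpleGraph.mem_incidenceFinset] at hza
      exact hza.2
    have h3 := card_le_card hJ'
    have h5 : H.incidenceFinset a ⊆ H.edgeFinset := fun z hz => by
      rw [SimpleGraph.mem_incidenceFinset] at hz
      simpa using hz.1
    rw [card_map, card_sdiff_of_subset h5, SimpleGraph.card_incidenceFinset_eq_degree] at h3
    have h4 := H.minDegree_le_degree a
    omega

/-- Without isolated vertices a copy is determined by its edge set, so copies can be counted as edge
sets. -/
theorem X_eq_card (hH : ∀ x, ∃ y, H.Adj x y) (G : SimpleGraph (Fin n)) [DecidableRel G.Adj] :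
    X H n G = #((copies H n).filter fun A => A ⊆ G.edgeFinset) := by
  classical
  have hsub : ∀ f : H.Copy G, f.toSubgraph.edgeSet = (edgesOf H f.toEmbedding : Set _) := fun f => by
    rw [SimpleGraph.Copy.toSubgraph, SimpleGraph.Subgraph.edgeSet_map]
    ext y
    rw [mem_coe, mem_edgesOf]
    rfl
  rw [X, SimpleGraph.copyCount_eq_card_image_copyToSubgraph]
  congr 1
  refine card_bij (fun G' _ => G'.edgeSet.toFinset) ?_ ?_ ?_
  · intro G' hG'
    obtain ⟨f, -, rfl⟩ := mem_image.1 hG'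
    simp only [hsub, toFinset_coe]
    refine mem_filter.2 ⟨mem_copies.2 ⟨_, rfl⟩, fun y hy => ?_⟩
    rw [SimpleGraph.mem_edgeFinset]
    have : y ∈ f.toSubgraph.edgeSet := by rw [hsub]; exact hy
    exact f.toSubgraph.edgeSet_subset this
  · intro G₁ h₁ G₂ h₂ h
    obtain ⟨f, -, rfl⟩ := mem_image.1 h₁
    obtain ⟨g, -, rfl⟩ := mem_image.1 h₂
    have he : f.toSubgraph.edgeSet = g.toSubgraph.edgeSet := by simpa using h
    have hadj : ∀ x y, f.toSubgraph.Adj x y ↔ g.toSubgraph.Adj x y := fun x y => by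
      rw [← SimpleGraph.Subgraph.mem_edgeSet, he, SimpleGraph.Subgraph.mem_edgeSet]
    have hv : ∀ f : H.Copy G, ∀ x, x ∈ f.toSubgraph.verts ↔ ∃ y, f.toSubgraph.Adj x y := by
      intro f x
      refine ⟨fun hx => ?_, fun ⟨y, hy⟩ => hy.fst_mem⟩
      obtain ⟨a, -, rfl⟩ := hx
      obtain ⟨b, hb⟩ := hH a
      exact ⟨f.toHom b, a, b, hb, rfl, rfl⟩
    refine SimpleGraph.Subgraph.ext (Set.ext fun x => ?_) (funext₂ fun x y => propext (hadj x y))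
    rw [hv, hv]
    simp_rw [hadj]
  · intro A hA
    obtain ⟨hA, hAG⟩ := mem_filter.1 hA
    obtain ⟨φ, rfl⟩ := mem_copies.1 hA
    let f : H.Copy G := ⟨⟨φ, fun {a b} hab => by
      have : s(φ a, φ b) ∈ edgesOf H φ := mem_edgesOf.2 ⟨s(a, b), hab, rfl⟩
      simpa using hAG this⟩, φ.injective⟩
    refine ⟨f.toSubgraph, mem_image.2 ⟨f, mem_univ _, rfl⟩, ?_⟩
    simp only [hsub, toFinset_coe]
    rfl

theorem card_copies_le : #(copies H n) ≤ n ^ Fintype.card V := by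
  calc _ ≤ #(univ : Finset (V ↪ Fin n)) := card_image_le
    _ = n.descFactorial (Fintype.card V) := by
        rw [card_univ, Fintype.card_embedding_eq, Fintype.card_fin]
    _ ≤ _ := Nat.descFactorial_le_pow _ _

theorem choose_le_card_copies (hH : ∀ x, ∃ y, H.Adj x y) :
    n.choose (Fintype.card V) ≤ #(copies H n) := by
  have h1 : powersetCard (Fintype.card V) (univ : Finset (Fin n)) ⊆
      (copies H n).image spanned := fun W hW => by
    have hW' := (mem_powersetCard.1 hW).2
    let g := Fintype.equivOfCardEq (α := V) (β := W) (by simpa using hW'.symm)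
    let φ : V ↪ Fin n := g.toEmbedding.trans (Function.Embedding.subtype _)
    refine mem_image.2 ⟨edgesOf H φ, mem_copies.2 ⟨φ, rfl⟩, ?_⟩
    rw [spanned_edgesOf hH]
    ext x
    simp only [mem_map, mem_univ, true_and]
    constructor
    · rintro ⟨a, rfl⟩
      exact (g a).2
    · intro hx
      exact ⟨g.symm ⟨x, hx⟩, by simp [φ]⟩
  have h2 := (card_le_card h1).trans card_image_le
  simpa [card_powersetCard] using h2

/-- Each v-set is spanned by some copy, so there are at least `n.choose v` ≥ (n + 1 - v)^v / v!
copies; moreover n ≤ v(n + 1 - v) when 1 ≤ v ≤ n. -/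
theorem pow_le_card_copies (hH : ∀ x, ∃ y, H.Adj x y) (hn : Fintype.card V ≤ n) :
    n ^ Fintype.card V ≤
      Fintype.card V ^ Fintype.card V * (Fintype.card V).factorial * #(copies H n) := by
  set v := Fintype.card V with hv
  rcases Nat.eq_zero_or_pos v with h0 | h0
  · have := choose_le_card_copies (n := n) hH
    rw [← hv, h0, Nat.choose_zero_right] at this
    simp only [h0]
    simpa using this
  have h1 : n ≤ v * (n + 1 - v) := by
    obtain ⟨k, rfl⟩ := Nat.exists_eq_add_of_le hn
    have h3 : v + k + 1 - v = k + 1 := by omega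
    have h4 : k ≤ v * k := Nat.le_mul_of_pos_left k h0
    rw [h3, Nat.mul_add]
    omega
  have h2 : (n + 1 - v) ^ v ≤ v.factorial * n.choose v := by
    have := Nat.pow_le_choose (α := ℚ) v n
    rw [div_le_iff₀ (by positivity)] at this
    have h : ((n + 1 - v) ^ v : ℕ) ≤ n.choose v * v.factorial := by exact_mod_cast this
    linarith
  calc n ^ v ≤ (v * (n + 1 - v)) ^ v := Nat.pow_le_pow_left h1 v
    _ = v ^ v * (n + 1 - v) ^ v := mul_pow _ _ _
    _ ≤ v ^ v * (v.factorial * n.choose v) := Nat.mul_le_mul_left _ h2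
    _ ≤ v ^ v * (v.factorial * #(copies H n)) := by
        gcongr
        exact choose_le_card_copies hH
    _ = _ := by ring

variable [DecidableEq V]

/-- The number of edges of `H` inside a vertex set. -/
def edgesInside (H : SimpleGraph V) [DecidableRel H.Adj] (Q : Finset V) : ℕ :=
  #(H.edgeFinset ∩ Q.sym2)

/-- Sort the embeddings by the set Q of vertices sent into W. At most v^v n^(v-#Q) embeddings belong
to a given Q, each petal has e - e(Q) edges, and being cored means 1 ≤ e(Q) < e. -/
theorem sum_cored_copies_le {p q : ℝ} (hp : 0 ≤ p) (hq0 : 0 ≤ q) (hv : 1 ≤ Fintype.card V)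
    (hq : ∀ Q : Finset V, 1 ≤ edgesInside H Q → edgesInside H Q < #H.edgeFinset →
      (n : ℝ) ^ (Fintype.card V - #Q) * p ^ (#H.edgeFinset - edgesInside H Q) ≤ q)
    {W : Finset (Fin n)} (hW : #W ≤ Fintype.card V) :
    ∑ a ∈ cored (copies H n) W, p ^ #(petal W a) ≤
      2 ^ Fintype.card V * Fintype.card V ^ Fintype.card V * q := by
  set v := Fintype.card V with hvdef
  let κ : (V ↪ Fin n) → Finset V := fun φ => univ.filter fun a => φ a ∈ W
  have hmem : ∀ (φ : V ↪ Fin n) (z : Sym2 V), Sym2.map φ z ∈ W.sym2 ↔ z ∈ (κ φ).sym2 := by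
    intro φ z
    simp [mem_sym2_iff, κ]
  have hinter : ∀ φ : V ↪ Fin n, edgesOf H φ ∩ W.sym2 =
      (H.edgeFinset ∩ (κ φ).sym2).map φ.sym2Map := by
    intro φ
    ext y
    rw [mem_inter, mem_edgesOf, mem_map]
    constructor
    · rintro ⟨⟨z, hz, rfl⟩, hy⟩
      exact ⟨z, mem_inter.2 ⟨by simpa using hz, (hmem φ z).1 hy⟩, rfl⟩
    · rintro ⟨z, hz, rfl⟩
      rw [mem_inter] at hz
      exact ⟨⟨z, by simpa using hz.1, rfl⟩, (hmem φ z).2 hz.2⟩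
  have hpetal : ∀ φ : V ↪ Fin n,
      #(petal W (edgesOf H φ)) = #H.edgeFinset - edgesInside H (κ φ) := by
    intro φ
    rw [petal, card_sdiff, inter_comm, hinter, card_map, card_edgesOf, edgesInside]
  have hcount : ∀ Q : Finset V, (#((univ : Finset (V ↪ Fin n)).filter fun φ => κ φ = Q) : ℝ) ≤
      v ^ v * (n : ℝ) ^ (v - #Q) := by
    intro Q
    have h1 : #((univ : Finset (V ↪ Fin n)).filter fun φ => κ φ = Q) ≤
        #(Fintype.piFinset fun a : V => if a ∈ Q then W else univ) := by
      refine card_le_card_of_injOn (fun φ => φ) (fun φ hφ => ?_) (fun φ _ ψ _ h => DFunLike.coe_injective h)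
      have hφ' : κ φ = Q := by simpa using hφ
      rw [mem_coe, Fintype.mem_piFinset]
      intro a
      split_ifs with ha
      · rw [← hφ'] at ha
        exact (mem_filter.1 ha).2
      · exact mem_univ _
    have h2 : #(Fintype.piFinset fun a : V => if a ∈ Q then W else univ) ≤
        v ^ v * n ^ (v - #Q) := by
      rw [Fintype.card_piFinset]
      calc ∏ a : V, #(if a ∈ Q then W else univ) = ∏ a : V, if a ∈ Q then #W else n :=
            prod_congr rfl fun a _ => by split_ifs <;> simp
        _ = #W ^ #Q * n ^ (v - #Q) := by
            rw [prod_ite, prod_const, prod_const, filter_mem_eq_inter, univ_inter,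
              filter_not, filter_mem_eq_inter, univ_inter, card_sdiff_of_subset (subset_univ _),
              card_univ]
        _ ≤ v ^ v * n ^ (v - #Q) := by
            gcongr
            exact Finset.card_le_univ Q
    exact_mod_cast h1.trans h2
  set Φ := (univ : Finset (V ↪ Fin n)).filter fun φ => edgesOf H φ ∈ cored (copies H n) W with hΦ
  have himg : cored (copies H n) W ⊆ Φ.image (edgesOf H) := fun a ha => by
    obtain ⟨φ, rfl⟩ := mem_copies.1 (mem_filter.1 ha).1
    exact mem_image.2 ⟨φ, mem_filter.2 ⟨mem_univ _, ha⟩, rfl⟩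
  have hκ : ∀ φ ∈ Φ, 1 ≤ edgesInside H (κ φ) ∧ edgesInside H (κ φ) < #H.edgeFinset := by
    intro φ hφ
    have h := (mem_filter.1 (mem_filter.1 hφ).2).2
    have h3 : edgesInside H (κ φ) = #(edgesOf H φ ∩ W.sym2) := by
      rw [hinter, card_map, edgesInside]
    rw [h3, ← card_edgesOf φ]
    refine ⟨card_pos.2 h.1, card_lt_card ⟨inter_subset_left, fun hc => h.2 ?_⟩⟩
    exact hc.trans inter_subset_right
  calc ∑ a ∈ cored (copies H n) W, p ^ #(petal W a)
      ≤ ∑ a ∈ Φ.image (edgesOf H), p ^ #(petal W a) :=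
        sum_le_sum_of_subset_of_nonneg himg fun _ _ _ => by positivity
    _ ≤ ∑ φ ∈ Φ, p ^ #(petal W (edgesOf H φ)) :=
        sum_image_le_of_nonneg (fun _ _ => by positivity)
    _ = ∑ Q : Finset V, ∑ φ ∈ Φ.filter fun φ => κ φ = Q, p ^ #(petal W (edgesOf H φ)) :=
        (sum_fiberwise _ _ _).symm
    _ ≤ ∑ Q : Finset V, v ^ v * q := by
        refine sum_le_sum fun Q _ => ?_
        rcases (Φ.filter fun φ => κ φ = Q).eq_empty_or_nonempty with h | ⟨φ₀, h₀⟩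
        · rw [h, sum_empty]
          positivity
        rw [mem_filter] at h₀
        obtain ⟨h1, h2⟩ := hκ φ₀ h₀.1
        rw [h₀.2] at h1 h2
        calc _ = ∑ φ ∈ Φ.filter fun φ => κ φ = Q, p ^ (#H.edgeFinset - edgesInside H Q) :=
              sum_congr rfl fun φ hφ => by rw [hpetal, (mem_filter.1 hφ).2]
          _ = #(Φ.filter fun φ => κ φ = Q) * p ^ (#H.edgeFinset - edgesInside H Q) := by
              rw [sum_const, nsmul_eq_mul]
          _ ≤ (v ^ v * (n : ℝ) ^ (v - #Q)) * p ^ (#H.edgeFinset - edgesInside H Q) := by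
              gcongr
              refine le_trans ?_ (hcount Q)
              exact_mod_cast card_le_card (filter_subset_filter _ (subset_univ _))
          _ = v ^ v * ((n : ℝ) ^ (v - #Q) * p ^ (#H.edgeFinset - edgesInside H Q)) := by ring
          _ ≤ v ^ v * q := by gcongr; exact hq Q h1 h2
    _ = _ := by
        rw [sum_const, card_univ, Fintype.card_finset, nsmul_eq_mul]
        push_cast
        ring

end Copies

/-! ### The binomial random graph -/

section BinomialRandom

open ProbabilityTheory

instance {n : ℕ} : MeasurableSingletonClass (SimpleGraph (Fin n)) where
  measurableSet_singleton G := by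
    rw [← SimpleGraph.measurableEmbedding_edgeSet.measurableSet_image, Set.image_singleton]
    exact measurableSet_singleton _

theorem binomialRandom_real_superset {n : ℕ} (p : unitInterval) (F : Finset (Sym2 (Fin n)))
    (hF : ∀ y ∈ F, ¬ y.IsDiag) :
    (SimpleGraph.binomialRandom (Fin n) p).real {G | (F : Set (Sym2 (Fin n))) ⊆ G.edgeSet} =
      (p : ℝ) ^ #F := by
  have h1 : (SimpleGraph.binomialRandom (Fin n) p) {G | (F : Set (Sym2 (Fin n))) ⊆ G.edgeSet} =
      setBernoulli (Sym2.diagSetᶜ : Set (Sym2 (Fin n))) p {s | (F : Set (Sym2 (Fin n))) ⊆ s} := by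
    rw [SimpleGraph.binomialRandom_eq_map, Measure.map_apply SimpleGraph.measurable_fromEdgeSet
      (Set.toFinite _).measurableSet]
    congr 1
    ext s
    simp only [Set.mem_preimage, Set.mem_ofPred_eq, SimpleGraph.edgeSet_fromEdgeSet]
    refine ⟨fun h y hy => (h hy).1, fun h y hy => ⟨h hy, ?_⟩⟩
    exact hF y hy
  rw [measureReal_def, h1, setBernoulli_apply']
  have h2 : (fun q : Sym2 (Fin n) → Prop => {i | q i}) ⁻¹' {s | (F : Set (Sym2 (Fin n))) ⊆ s} =
      Set.pi F fun _ => {True} := by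
    ext q
    simp [Set.subset_def, Set.mem_pi]
  rw [h2, Measure.infinitePi_pi _ (fun _ _ => MeasurableSet.of_discrete)]
  rw [prod_congr rfl (g := fun _ => (unitInterval.toNNReal p : ENNReal)) fun y hy => ?_]
  · simp
  · have := hF y hy
    simp [this]

open Classical in
theorem binomialRandom_real_edgeFinset {n : ℕ} (p : unitInterval) (F : Finset (Sym2 (Fin n)))
    (hF : ∀ y ∈ F, ¬ y.IsDiag) :
    (SimpleGraph.binomialRandom (Fin n) p).real {G | F ⊆ G.edgeFinset} = (p : ℝ) ^ #F := by
  rw [← binomialRandom_real_superset p F hF]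
  congr 1
  ext G
  simp [← coe_subset]

open Classical in
theorem binomialRandom_real_edgeFinset_le {n : ℕ} (p : unitInterval)
    (F : Finset (Sym2 (Fin n))) :
    (SimpleGraph.binomialRandom (Fin n) p).real {G | F ⊆ G.edgeFinset} ≤ (p : ℝ) ^ #F := by
  by_cases hF : ∀ y ∈ F, ¬ y.IsDiag
  · exact (binomialRandom_real_edgeFinset p F hF).le
  · have : {G : SimpleGraph (Fin n) | F ⊆ G.edgeFinset} = ∅ := by
      refine Set.eq_empty_of_forall_notMem fun G hG => hF fun y hy => ?_
      exact G.not_isDiag_of_mem_edgeFinset (hG hy)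
    rw [this, measureReal_empty]
    exact pow_nonneg p.2.1 _

variable {V : Type*} [Fintype V] {H : SimpleGraph V} [DecidableRel H.Adj] {n : ℕ}

open Classical in
theorem X_eq_sum_indicator (hH : ∀ x, ∃ y, H.Adj x y) (G : SimpleGraph (Fin n)) :
    X H n G = ∑ A ∈ copies H n,
      {G : SimpleGraph (Fin n) | A ⊆ G.edgeFinset}.indicator (fun _ => (1 : ℝ)) G := by
  rw [X_eq_card hH, card_filter]
  push_cast
  exact sum_congr rfl fun A _ => by simp [Set.indicator_apply]

theorem mean_eq_sum (hH : ∀ x, ∃ y, H.Adj x y) (p : unitInterval) :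
    mean H n p = ∑ A ∈ copies H n, (p : ℝ) ^ #A := by
  classical
  simp_rw [mean, X_eq_sum_indicator hH]
  rw [integral_finsetSum _ fun _ _ => Integrable.of_finite]
  refine sum_congr rfl fun A hA => ?_
  rw [integral_indicator_const _ (Set.toFinite _).measurableSet,
    binomialRandom_real_edgeFinset p A fun y => not_isDiag_of_mem_copies hA]
  simp

theorem mean_eq (hH : ∀ x, ∃ y, H.Adj x y) (p : unitInterval) :
    mean H n p = #(copies H n) * (p : ℝ) ^ #H.edgeFinset := by
  rw [mean_eq_sum hH, sum_congr rfl fun A hA => by rw [card_of_mem_copies hA], sum_const,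
    nsmul_eq_mul]

/-- All covariances of copy indicators are nonnegative, because #(A ∪ B) ≤ 2e; keeping only the
terms A = B gives the bound. -/
theorem mean_mul_le_var (hH : ∀ x, ∃ y, H.Adj x y) (p : unitInterval) :
    mean H n p * (1 - (p : ℝ) ^ #H.edgeFinset) ≤ var H n p := by
  classical
  have hp0 : (0 : ℝ) ≤ p := p.2.1
  have hp1 : (p : ℝ) ≤ 1 := p.2.2
  have hX : MemLp (X H n) 2 (SimpleGraph.binomialRandom (Fin n) p) := MemLp.of_discrete
  rw [var, variance_eq_sub hX]
  have h2 : ∫ G, (X H n ^ 2) G ∂(SimpleGraph.binomialRandom (Fin n) p) =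
      ∑ A ∈ copies H n, ∑ B ∈ copies H n, (p : ℝ) ^ #(A ∪ B) := by
    have : ∀ G : SimpleGraph (Fin n), (X H n ^ 2) G = ∑ A ∈ copies H n, ∑ B ∈ copies H n,
        {G : SimpleGraph (Fin n) | A ∪ B ⊆ G.edgeFinset}.indicator (fun _ => (1 : ℝ)) G := by
      intro G
      rw [Pi.pow_apply, X_eq_sum_indicator hH, sq, sum_mul_sum]
      refine sum_congr rfl fun A _ => sum_congr rfl fun B _ => ?_
      simp only [Set.indicator_apply, Set.mem_ofPred_eq, union_subset_iff]
      split_ifs <;> simp_all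
    simp_rw [this]
    rw [integral_finsetSum _ fun _ _ => Integrable.of_finite]
    refine sum_congr rfl fun A hA => ?_
    rw [integral_finsetSum _ fun _ _ => Integrable.of_finite]
    refine sum_congr rfl fun B hB => ?_
    rw [integral_indicator_const _ (Set.toFinite _).measurableSet,
      binomialRandom_real_edgeFinset p (A ∪ B) fun y hy => ?_]
    · simp
    · rcases mem_union.1 hy with h | h
      · exact not_isDiag_of_mem_copies hA h
      · exact not_isDiag_of_mem_copies hB h
  set e := #H.edgeFinset with he
  set N := #(copies H n) with hN
  have h3 : ∀ A ∈ copies H n, N * (p : ℝ) ^ (e + e) + ((p : ℝ) ^ e - (p : ℝ) ^ (e + e)) ≤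
      ∑ B ∈ copies H n, (p : ℝ) ^ #(A ∪ B) := by
    intro A hA
    have hc : ∀ B ∈ copies H n, #(A ∪ B) ≤ e + e := fun B hB => by
      rw [he, ← card_of_mem_copies hA]
      nth_rewrite 2 [card_of_mem_copies hA]
      rw [← card_of_mem_copies hB]
      exact card_union_le _ _
    have : ((p : ℝ) ^ e - (p : ℝ) ^ (e + e)) ≤
        ∑ B ∈ copies H n, ((p : ℝ) ^ #(A ∪ B) - (p : ℝ) ^ (e + e)) := by
      refine le_trans (le_of_eq ?_) (single_le_sum (fun B hB => ?_) hA)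
      · rw [union_self, card_of_mem_copies hA]
      · exact sub_nonneg.2 (pow_le_pow_of_le_one hp0 hp1 (hc B hB))
    rw [sum_sub_distrib, sum_const, nsmul_eq_mul] at this
    linarith
  have h4 := card_nsmul_le_sum _ _ _ h3
  have h5 : ∫ G, X H n G ∂(SimpleGraph.binomialRandom (Fin n) p) = mean H n p := rfl
  rw [h2, h5, mean_eq hH]
  rw [nsmul_eq_mul, pow_add] at h4
  nlinarith [h4]

end BinomialRandom

/-! ### The upper tail when copies rarely overlap -/

section Key

theorem card_cores_le {n v : ℕ} (hn : 1 ≤ n) :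
    #((univ : Finset (Finset (Fin n))).filter fun W => #W ≤ v) ≤ (v + 1) * n ^ v := by
  have h : (univ : Finset (Finset (Fin n))).filter (fun W => #W ≤ v) ⊆
      (range (v + 1)).biUnion fun i => powersetCard i univ := fun W hW => by
    have := (mem_filter.1 hW).2
    exact mem_biUnion.2 ⟨#W, mem_range.2 (by omega), mem_powersetCard.2 ⟨subset_univ _, rfl⟩⟩
  refine (card_le_card h).trans ((card_biUnion_le_card_mul _ _ (n ^ v) fun i hi => ?_).trans
    (by rw [card_range]))
  rw [card_powersetCard, card_univ, Fintype.card_fin]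
  exact (Nat.choose_le_pow n i).trans
    (Nat.pow_le_pow_right hn (by have := mem_range.1 hi; omega))

/-- For large n, half of the exponent η absorbs C. Half of the remaining gain beats the n^(v+1) that
bounds N once k ≥ 4(v + 1)/η, leaving n^(-η/4) per petal. -/
theorem exists_sunflower_params (v : ℕ) (C : ℝ) {η : ℝ} (hη : 0 < η) :
    ∃ k n₁ : ℕ, 1 ≤ k ∧ ∀ (n r : ℕ) (N q : ℝ), n₁ ≤ n → 1 ≤ n → k ≤ r → 0 ≤ N → 0 ≤ q →
      N ≤ (v + 1) * (n : ℝ) ^ v → q ≤ C * (n : ℝ) ^ (-η) →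
      N * q ^ r + (N * q ^ k) ^ r ≤ 2 * Real.exp (-(η / 4 * r * Real.log n)) := by
  have h1 : ∀ᶠ n : ℕ in Filter.atTop, C ≤ (n : ℝ) ^ (η / 2) :=
    ((tendsto_rpow_atTop (half_pos hη)).comp tendsto_natCast_atTop_atTop).eventually_ge_atTop C
  obtain ⟨n₁, hn₁⟩ := Filter.eventually_atTop.1 (h1.and (Filter.eventually_ge_atTop (v + 1)))
  refine ⟨⌈4 * (v + 1) / η⌉₊ + 1, n₁, by omega, fun n r N q hn hn1 hr hN0 hq0 hN hq => ?_⟩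
  set k := ⌈4 * (v + 1) / η⌉₊ + 1 with hk
  obtain ⟨hC, hvn⟩ := hn₁ n hn
  have hx : (1 : ℝ) ≤ n := by exact_mod_cast hn1
  have hx0 : (0 : ℝ) < n := by linarith
  have hkη : ∀ l : ℕ, k ≤ l → (v + 1 : ℝ) ≤ η / 4 * l := fun l hl => by
    have h2 : 4 * (v + 1) / η ≤ (⌈4 * (v + 1) / η⌉₊ : ℝ) := Nat.le_ceil _
    have h3 : (k : ℝ) ≤ l := Nat.cast_le.2 hl
    rw [hk] at h3
    push_cast at h3
    have h4 : 4 * (v + 1) / η ≤ l := by linarith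
    rw [div_le_iff₀ hη] at h4
    linarith
  have hq' : q ≤ (n : ℝ) ^ (-(η / 2)) := by
    calc q ≤ (n : ℝ) ^ (η / 2) * (n : ℝ) ^ (-η) := hq.trans (by gcongr)
      _ = _ := by rw [← Real.rpow_add hx0]; ring_nf
  have hN' : N ≤ (n : ℝ) ^ ((v : ℝ) + 1) := by
    rw [Real.rpow_add hx0, Real.rpow_one, Real.rpow_natCast, mul_comm]
    refine hN.trans ?_
    gcongr
    exact_mod_cast hvn
  have key : ∀ l : ℕ, k ≤ l → N * q ^ l ≤ (n : ℝ) ^ (-(η / 4 * l)) := fun l hl => by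
    calc N * q ^ l ≤ (n : ℝ) ^ ((v : ℝ) + 1) * ((n : ℝ) ^ (-(η / 2))) ^ l := by gcongr
      _ = (n : ℝ) ^ ((v : ℝ) + 1 + -(η / 2) * l) := by
          rw [← Real.rpow_natCast, ← Real.rpow_mul hx0.le, ← Real.rpow_add hx0]
      _ ≤ _ := Real.rpow_le_rpow_of_exponent_le hx (by have := hkη l hl; linarith)
  have h5 : (N * q ^ k) ^ r ≤ (n : ℝ) ^ (-(η / 4 * r)) := by
    calc (N * q ^ k) ^ r ≤ ((n : ℝ) ^ (-(η / 4))) ^ r := by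
          gcongr
          refine (key k le_rfl).trans (Real.rpow_le_rpow_of_exponent_le hx ?_)
          have : (1 : ℝ) ≤ k := by rw [hk]; push_cast; linarith [Nat.cast_nonneg (α := ℝ) ⌈4 * (v + 1) / η⌉₊]
          nlinarith
      _ = _ := by rw [← Real.rpow_natCast, ← Real.rpow_mul hx0.le]; ring_nf
  have h6 : (n : ℝ) ^ (-(η / 4 * r)) = Real.exp (-(η / 4 * r * Real.log n)) := by
    rw [Real.rpow_def_of_pos hx0]
    ring_nf
  rw [← h6]
  linarith [key r hr]

theorem upperTail_le_one {V : Type*} {H : SimpleGraph V} (n : ℕ) (p : unitInterval) (x : ℝ) : upperTail H n p x ≤ 1 :=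
  measureReal_le_one

/-- Since 3/e > 1, the prefactor 3 makes the bound trivial for bounded exponents; this disposes of
small n, t or μ. -/
theorem upperTail_le_of_exponent_le {V : Type*} {H : SimpleGraph V} {n : ℕ} {p : unitInterval} {x y : ℝ} (hy : y ≤ 1) :
    upperTail H n p x ≤ 3 * Real.exp (-y) := by
  have h1 : Real.exp (-1) ≤ Real.exp (-y) := Real.exp_le_exp.2 (by linarith)
  have h2 := Real.exp_neg_one_gt_d9
  linarith [upperTail_le_one (H := H) n p x]

variable {V : Type*} [Fintype V] {H : SimpleGraph V} [DecidableRel H.Adj]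

theorem one_le_sParam (hv : 2 ≤ Fintype.card V) : 1 ≤ sParam H :=
  le_min (by omega) (by omega)

theorem upperTail_le_of_edgesInside [DecidableEq V] (hH : ∀ x, ∃ y, H.Adj x y) (hv : 2 ≤ Fintype.card V)
    (he : 1 ≤ #H.edgeFinset) {K Λ η : ℝ} (hK : 0 < K) (hΛ : 0 < Λ) (hη : 0 < η) :
    ∃ c : ℝ, 0 < c ∧ ∀ (n : ℕ) (t : ℝ) (p : unitInterval), Fintype.card V ≤ n →
      (∀ Q : Finset V, 1 ≤ edgesInside H Q → edgesInside H Q < #H.edgeFinset →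
        (n : ℝ) ^ (Fintype.card V - #Q) * (p : ℝ) ^ (#H.edgeFinset - edgesInside H Q) ≤
          K * (n : ℝ) ^ (-η)) →
      0 < t → t ≤ Λ * mean H n p →
      t ^ 2 / mean H n p ≤ Λ * t ^ (1 / (sParam H : ℝ)) * Real.log n →
      upperTail H n p (mean H n p + t) ≤ 3 * Real.exp (-(c * (t ^ 2 / mean H n p))) := by
  set v := Fintype.card V with hvdef
  set e := #H.edgeFinset with hedef
  set s := sParam H with hsdef
  have hs : 1 ≤ s := one_le_sParam hv
  have hs0 : (0 : ℝ) < s := by exact_mod_cast hs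
  have he0 : (1 : ℝ) ≤ e := by exact_mod_cast he
  obtain ⟨k, n₁, hk, hparam⟩ := exists_sunflower_params v (2 ^ v * v ^ v * K) hη
  have hk0 : (1 : ℝ) ≤ k := by exact_mod_cast hk
  obtain ⟨B, hB⟩ : ∃ x : ℝ, x = 2 ^ (v + 1).choose 2 := ⟨_, rfl⟩
  have hB0 : 1 ≤ B := hB ▸ one_le_pow₀ (by norm_num)
  obtain ⟨D, hD⟩ : ∃ x : ℝ, x = e * (B * (1 + k * e) ^ (s - 1)) := ⟨_, rfl⟩
  have hD0 : 0 < D := by rw [hD]; positivity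
  obtain ⟨C₂, hC₂⟩ : ∃ x : ℝ, x = k * e * B * (2 * e) ^ (s - 1) := ⟨_, rfl⟩
  have hC₂0 : 0 < C₂ := by rw [hC₂]; positivity
  obtain ⟨T₀, hT₀⟩ : ∃ x : ℝ, x = 2 * C₂ * (k + 1) ^ s := ⟨_, rfl⟩
  have hT₀0 : 0 < T₀ := by rw [hT₀]; positivity
  obtain ⟨c₃, hc₃⟩ : ∃ x : ℝ, x = (1 / (2 * C₂)) ^ (1 / (s : ℝ)) / 2 := ⟨_, rfl⟩
  have hc₃0 : 0 < c₃ := by rw [hc₃]; positivity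
  -- The four bounds serve, in order, the sunflower error, the Chernoff term, the case t < T₀ and
  -- the case n < n₁.
  obtain ⟨c, hc⟩ : ∃ x : ℝ, x = min (min (η / 4 * c₃ / Λ) (1 / (16 * D * (1 + Λ))))
    (min (1 / (T₀ * Λ)) (1 / (Λ ^ 2 * (n₁ + 1) ^ v))) := ⟨_, rfl⟩
  have hc0 : 0 < c := by rw [hc]; positivity
  obtain ⟨⟨hcη, hcD⟩, hcT, hcn⟩ : (c ≤ η / 4 * c₃ / Λ ∧ c ≤ 1 / (16 * D * (1 + Λ))) ∧
      c ≤ 1 / (T₀ * Λ) ∧ c ≤ 1 / (Λ ^ 2 * (n₁ + 1) ^ v) := by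
    rw [← le_min_iff, ← le_min_iff, ← le_min_iff, hc]
  refine ⟨c, hc0, fun n t p hn hQ ht htΛ htlog => ?_⟩
  set m := mean H n p with hm
  have hm0 : 0 < m := by
    by_contra h
    push Not at h
    nlinarith
  have hp0 : (0 : ℝ) ≤ p := p.2.1
  have hp1 : (p : ℝ) ≤ 1 := p.2.2
  have hy0 : 0 ≤ t ^ 2 / m := by positivity
  have hcy : ∀ c', c ≤ c' → c * (t ^ 2 / m) ≤ c' * (t ^ 2 / m) := fun c' h => by gcongr
  by_cases hT : t < T₀
  · refine upperTail_le_of_exponent_le ((hcy _ hcT).trans ?_)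
    · rw [div_mul_div_comm, one_mul, div_le_one (by positivity)]
      calc t ^ 2 = t * t := sq t
        _ ≤ T₀ * (Λ * m) := by gcongr
        _ = _ := by ring
  push Not at hT
  by_cases hn₁ : n < n₁
  · refine upperTail_le_of_exponent_le ((hcy _ hcn).trans ?_)
    · rw [div_mul_div_comm, one_mul, div_le_one (by positivity)]
      have h1 : m ≤ (n₁ + 1 : ℝ) ^ v := by
        rw [hm, mean_eq hH]
        calc (#(copies H n) : ℝ) * (p : ℝ) ^ e ≤ (n : ℝ) ^ v * 1 := by
              gcongr
              · exact_mod_cast card_copies_le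
              · exact pow_le_one₀ hp0 hp1
          _ ≤ _ := by
              rw [mul_one]
              gcongr
              exact_mod_cast (by omega : n ≤ n₁ + 1)
      calc t ^ 2 ≤ (Λ * m) ^ 2 := by gcongr
        _ = Λ ^ 2 * m * m := by ring
        _ ≤ Λ ^ 2 * (n₁ + 1) ^ v * m := by gcongr
  push Not at hn₁
  have hn1 : 1 ≤ n := by omega
  -- The deletion costs at most C₂ r^s, so z is the largest r that keeps it below t/2. The threshold
  -- T₀ ensures z ≥ k + 1, hence k ≤ r and r ≥ z/2.
  set z : ℝ := (t / (2 * C₂)) ^ (1 / (s : ℝ)) with hz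
  set r := ⌊z⌋₊ with hr
  have hz0 : 0 ≤ z := by positivity
  have hzs : z ^ s = t / (2 * C₂) := by
    rw [hz, ← Real.rpow_natCast, ← Real.rpow_mul (by positivity),
      one_div_mul_cancel hs0.ne', Real.rpow_one]
  have hkz : (k + 1 : ℝ) ≤ z := by
    refine le_of_pow_le_pow_left₀ (by omega : s ≠ 0) hz0 ?_
    rw [hzs, le_div_iff₀ (by positivity)]
    linarith
  have hrz : (r : ℝ) ≤ z := Nat.floor_le hz0
  have hzr : z < r + 1 := Nat.lt_floor_add_one z
  have hkr : k ≤ r := by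
    have : (k : ℝ) < r + 1 := by linarith
    have : k < r + 1 := by exact_mod_cast this
    omega
  have hr0 : (1 : ℝ) ≤ r := by exact_mod_cast hk.trans hkr
  have hrc : c₃ * t ^ (1 / (s : ℝ)) ≤ r := by
    have : c₃ * t ^ (1 / (s : ℝ)) = z / 2 := by
      rw [hz, hc₃, div_eq_mul_one_div t, Real.mul_rpow ht.le (by positivity)]
      ring
    rw [this]
    linarith
  have hrτ : (r * (k * e) * (B * (1 + r * e) ^ (s - 1)) : ℝ) ≤ t / 2 := by
    calc (r * (k * e) * (B * (1 + r * e) ^ (s - 1)) : ℝ)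
        ≤ r * (k * e) * (B * (r * (2 * e)) ^ (s - 1)) := by
          gcongr
          nlinarith
      _ = C₂ * r ^ (s - 1 + 1) := by rw [hC₂, mul_pow, pow_succ]; ring
      _ = C₂ * r ^ s := by rw [Nat.sub_add_cancel hs]
      _ ≤ C₂ * z ^ s := by gcongr
      _ = t / 2 := by rw [hzs, mul_comm 2, ← div_div, mul_div_assoc', mul_div_cancel₀ _ hC₂0.ne']
  have hn0 : (0 : ℝ) < n := by exact_mod_cast hn1
  classical
  have htail := prob_upper_tail_le (SimpleGraph.binomialRandom (Fin n) p)
    (S := fun G => G.edgeFinset) hp0 (binomialRandom_real_edgeFinset_le p) (copies H n)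
    (r := r) (k := k) (τ := t / 2) (Λ := Λ) hs he (fun a ha y => not_isDiag_of_mem_copies ha)
    (fun a ha => (card_of_mem_copies ha).le) (fun a ha => (card_spanned_of_mem_copies hH ha).le)
    (fun a ha J hJ => spanned_eq_of_sParam_le hH ha hJ)
    (fun W hW => sum_cored_copies_le hp0 (by positivity) (by omega) hQ hW)
    (mean_eq_sum hH p) hm0 (by positivity) (by linarith) (hB ▸ hrτ)
  rw [← hvdef, ← hm, ← hB, ← hD] at htail
  have hev : {G : SimpleGraph (Fin n) | m + 2 * (t / 2) ≤
      #((copies H n).filter fun a => a ⊆ G.edgeFinset)} = {G | m + t ≤ X H n G} := by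
    ext G
    simp only [Set.mem_ofPred_eq]
    rw [X_eq_card hH, mul_div_cancel₀ _ two_ne_zero]
  rw [hev] at htail
  have hbad := hparam n r _ _ hn₁ hn1 hkr (Nat.cast_nonneg _)
    (by positivity : (0 : ℝ) ≤ 2 ^ v * v ^ v * (K * (n : ℝ) ^ (-η)))
    (by exact_mod_cast card_cores_le (v := v) hn1) (by rw [← mul_assoc])
  refine htail.trans ?_
  have hlog : 0 ≤ Real.log n := Real.log_nonneg (by exact_mod_cast hn1)
  have e1 : c * (t ^ 2 / m) ≤ (t / 2) ^ 2 / (4 * D * ((1 + Λ) * m)) := by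
    refine (hcy _ hcD).trans
      (le_of_eq ?_)
    field_simp
    norm_num
  have e2 : c * (t ^ 2 / m) ≤ η / 4 * r * Real.log n := by
    calc c * (t ^ 2 / m) ≤ η / 4 * c₃ / Λ * (t ^ 2 / m) :=
          hcy _ hcη
      _ ≤ η / 4 * c₃ / Λ * (Λ * t ^ (1 / (s : ℝ)) * Real.log n) := by gcongr
      _ = η / 4 * (c₃ * t ^ (1 / (s : ℝ))) * Real.log n := by field_simp
      _ ≤ _ := by gcongr
  have f1 := Real.exp_le_exp.2 (neg_le_neg e1)
  have f2 := Real.exp_le_exp.2 (neg_le_neg e2)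
  linarith

end Key

/-! ### Balanced graphs -/

section Balanced

theorem ncard_verts_induce {V : Type*} {H : SimpleGraph V} (Q : Finset V) :
    ((⊤ : H.Subgraph).induce (Q : Set V)).verts.ncard = #Q := by
  rw [SimpleGraph.Subgraph.induce_verts, Set.ncard_coe_finset]

theorem ncard_verts_top {V : Type*} [Fintype V] {H : SimpleGraph V} : (⊤ : H.Subgraph).verts.ncard = Fintype.card V := by
  rw [SimpleGraph.Subgraph.verts_top, Set.ncard_univ, Nat.card_eq_fintype_card]

theorem induce_erase_ne_top {V : Type*} [Fintype V] [DecidableEq V] {H : SimpleGraph V} (x : V) :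
    (⊤ : H.Subgraph).induce ((univ.erase x : Finset V) : Set V) ≠ ⊤ := fun hc => by
  have := congrArg SimpleGraph.Subgraph.verts hc
  rw [SimpleGraph.Subgraph.induce_verts, SimpleGraph.Subgraph.verts_top] at this
  have hx : x ∈ ((univ.erase x : Finset V) : Set V) := by rw [this]; trivial
  simp at hx

variable {V : Type*} [Fintype V] {H : SimpleGraph V} [DecidableRel H.Adj]

theorem ncard_edgeSet : H.edgeSet.ncard = #H.edgeFinset := by
  rw [← SimpleGraph.coe_edgeFinset, Set.ncard_coe_finset]

theorem ncard_edgeSet_top : (⊤ : H.Subgraph).edgeSet.ncard = #H.edgeFinset := by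
  rw [SimpleGraph.Subgraph.edgeSet_top, ncard_edgeSet]

theorem StrictlyBalanced.one_le (h : StrictlyBalanced H) : 1 ≤ #H.edgeFinset := by
  rw [← ncard_edgeSet]
  exact h.1

theorem TwoBalanced.two_le (h : TwoBalanced H) : 2 ≤ #H.edgeFinset := by
  rw [← ncard_edgeSet]
  exact h.1

variable [DecidableEq V]

theorem ncard_edgeSet_induce (Q : Finset V) :
    ((⊤ : H.Subgraph).induce (Q : Set V)).edgeSet.ncard = edgesInside H Q := by
  rw [edgesInside, ← Set.ncard_coe_finset]
  congr 1
  ext z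
  induction z with
  | _ a b =>
    simp only [SimpleGraph.Subgraph.mem_edgeSet, SimpleGraph.Subgraph.induce_adj,
      SimpleGraph.Subgraph.top_adj, coe_inter, Set.mem_inter_iff, mem_coe,
      SimpleGraph.mem_edgeFinset, SimpleGraph.mem_edgeSet, mk_mem_sym2_iff]
    tauto

theorem edgesInside_univ : edgesInside H univ = #H.edgeFinset := by
  rw [edgesInside, sym2_univ, inter_univ]

theorem two_le_card_of_edgesInside {Q : Finset V} (h : 1 ≤ edgesInside H Q) : 2 ≤ #Q := by
  obtain ⟨z, hz⟩ := card_pos.1 h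
  rw [mem_inter, SimpleGraph.mem_edgeFinset] at hz
  rw [← Sym2.card_toFinset_of_not_isDiag z (H.not_isDiag_of_mem_edgeSet hz.1)]
  exact card_le_card fun x hx => mem_sym2_iff.1 hz.2 x (Sym2.mem_toFinset.1 hx)

theorem three_le_card_of_edgesInside {Q : Finset V} (h : 2 ≤ edgesInside H Q) : 3 ≤ #Q := by
  obtain ⟨z, hz, w, hw, hne⟩ := one_lt_card.1 h
  rw [mem_inter, SimpleGraph.mem_edgeFinset] at hz hw
  by_contra hc
  have hsub : ∀ z, z ∈ H.edgeSet → z ∈ Q.sym2 → z.toFinset = Q := fun z h1 h2 => by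
    refine eq_of_subset_of_card_le
      (fun x hx => mem_sym2_iff.1 h2 x (Sym2.mem_toFinset.1 hx)) ?_
    rw [Sym2.card_toFinset_of_not_isDiag z (H.not_isDiag_of_mem_edgeSet h1)]
    omega
  refine hne (Sym2.ext fun x => ?_)
  rw [← Sym2.mem_toFinset, ← Sym2.mem_toFinset, hsub z hz.1 hz.2, hsub w hw.1 hw.2]

theorem induce_ne_top_of_edgesInside_lt {Q : Finset V} (h : edgesInside H Q < #H.edgeFinset) :
    (⊤ : H.Subgraph).induce (Q : Set V) ≠ ⊤ := fun hc => by
  have := ncard_edgeSet_induce (H := H) Q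
  rw [hc, ncard_edgeSet_top] at this
  omega

theorem edgesInside_erase_of_isolated {x : V} (hx : ∀ y, ¬ H.Adj x y) :
    edgesInside H (univ.erase x) = #H.edgeFinset := by
  rw [edgesInside, inter_eq_left.2]
  intro z hz
  rw [mem_sym2_iff]
  intro a ha
  refine mem_erase.2 ⟨?_, mem_univ _⟩
  rintro rfl
  obtain ⟨b, rfl⟩ := Sym2.mem_iff_exists.1 ha
  exact hx b (by simpa using hz)

/-- Deleting an isolated vertex keeps the edges and does not lower the density, contradicting strict
balance. The 2-density would even rise strictly, which gives the 2-balanced analogue. -/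
theorem StrictlyBalanced.exists_adj (h : StrictlyBalanced H) (x : V) : ∃ y, H.Adj x y := by
  by_contra hx
  push Not at hx
  have he := edgesInside_erase_of_isolated hx
  have h1 := two_le_card_of_edgesInside (he ▸ h.one_le)
  have h2 := h.2 _ (induce_erase_ne_top x) (by rw [ncard_verts_induce]; omega)
  rw [density, density, ncard_edgeSet_induce, ncard_verts_induce, ncard_edgeSet_top,
    ncard_verts_top, he] at h2
  refine absurd h2 (not_lt.2 ?_)
  have h3 : (2 : ℝ) ≤ #(univ.erase x) := by exact_mod_cast h1
  gcongr
  exact card_le_univ _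

theorem TwoBalanced.exists_adj (h : TwoBalanced H) (x : V) : ∃ y, H.Adj x y := by
  by_contra hx
  push Not at hx
  have he := edgesInside_erase_of_isolated hx
  have h1 := three_le_card_of_edgesInside (he ▸ h.two_le)
  have h2 := h.2 _ (induce_erase_ne_top x) (by rw [ncard_verts_induce]; omega)
  rw [density₂, density₂, ncard_edgeSet_induce, ncard_verts_induce, ncard_edgeSet_top,
    ncard_verts_top, he] at h2
  refine absurd h2 (not_le.2 ?_)
  have h3 : (3 : ℝ) ≤ #(univ.erase x) := by exact_mod_cast h1
  have h4 : (2 : ℝ) ≤ #H.edgeFinset := by exact_mod_cast h.two_le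
  have h5 : (#(univ.erase x) : ℝ) < Fintype.card V := by
    exact_mod_cast card_lt_univ_of_notMem (notMem_erase x univ)
  exact div_lt_div_of_pos_left (by linarith) (by linarith) (by linarith)

theorem StrictlyBalanced.edgesInside_mul_lt (h : StrictlyBalanced H) {Q : Finset V}
    (h1 : 1 ≤ edgesInside H Q) (h2 : edgesInside H Q < #H.edgeFinset) :
    edgesInside H Q * Fintype.card V < #H.edgeFinset * #Q := by
  have hQ := two_le_card_of_edgesInside h1
  have h3 := h.2 _ (induce_ne_top_of_edgesInside_lt h2) (by rw [ncard_verts_induce]; omega)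
  rw [density, density, ncard_edgeSet_induce, ncard_verts_induce, ncard_edgeSet_top,
    ncard_verts_top, div_lt_div_iff₀] at h3
  · exact_mod_cast h3
  · exact_mod_cast (by omega : 0 < #Q)
  · exact_mod_cast lt_of_lt_of_le (by omega : 0 < #Q) (card_le_univ Q)

theorem TwoBalanced.sub_mul_le (h : TwoBalanced H) {Q : Finset V}
    (h1 : 1 ≤ edgesInside H Q) (h2 : edgesInside H Q < #H.edgeFinset) :
    ((#H.edgeFinset : ℝ) - 1) * (Fintype.card V - #Q) ≤
      ((Fintype.card V : ℝ) - 2) * (#H.edgeFinset - edgesInside H Q) := by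
  have hQ := two_le_card_of_edgesInside h1
  have hQV := card_le_univ Q
  rcases hQ.eq_or_lt with hQ | hQ
  -- The 2-density condition is silent about two-vertex subgraphs; for a single edge the inequality
  -- is an equality.
  · have h3 : edgesInside H Q = 1 := by
      by_contra hc
      have := three_le_card_of_edgesInside (H := H) (Q := Q) (by omega)
      omega
    rw [h3, ← hQ]
    push_cast
    linarith
  · have h3 := h.2 _ (induce_ne_top_of_edgesInside_lt h2) (by rw [ncard_verts_induce]; omega)
    have h4 : (3 : ℝ) ≤ #Q := by exact_mod_cast hQ
    have h5 : (#Q : ℝ) ≤ Fintype.card V := by exact_mod_cast hQV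
    rw [density₂, density₂, ncard_edgeSet_induce, ncard_verts_induce, ncard_edgeSet_top,
      ncard_verts_top, div_le_div_iff₀ (by linarith) (by linarith)] at h3
    linarith

/-- Two edges need v ≥ 3 vertices, and vδ ≤ 2e then forces δ < e. -/
theorem two_le_sParam (he : 2 ≤ #H.edgeFinset) : 2 ≤ sParam H := by
  have hv := three_le_card_of_edgesInside (edgesInside_univ (H := H) ▸ he)
  rw [card_univ] at hv
  have h1 : Fintype.card V * H.minDegree ≤ 2 * #H.edgeFinset := by
    rw [← H.sum_degrees_eq_twice_card_edges, ← smul_eq_mul, ← card_univ]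
    exact card_nsmul_le_sum _ _ _ fun x _ => H.minDegree_le_degree x
  have h2 : 3 * H.minDegree ≤ 2 * #H.edgeFinset := (Nat.mul_le_mul_right _ hv).trans h1
  rw [sParam, ncard_edgeSet]
  exact le_min (by omega) (by omega)

theorem two_le_card (he : 1 ≤ #H.edgeFinset) : 2 ≤ Fintype.card V := by
  rw [← card_univ]
  exact two_le_card_of_edgesInside (edgesInside_univ (H := H) ▸ he)

/-- By 2-balancedness, v - #Q is at most (v - 2)/(e - 1) times the number of petal edges. The
threshold part of p thus cancels the power of n, and at least one factor n^(-σ) is left. -/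
theorem TwoBalanced.pow_mul_pow_le (h : TwoBalanced H) {n : ℕ} (hn : 1 ≤ n) {p σ Λ : ℝ}
    (hp : 0 ≤ p) (hσ : 0 < σ)
    (hpΛ : p ≤ Λ * (n : ℝ) ^
      (-(((Fintype.card V : ℝ) - 2) / ((#H.edgeFinset : ℝ) - 1)) - σ))
    {Q : Finset V} (h1 : 1 ≤ edgesInside H Q) (h2 : edgesInside H Q < #H.edgeFinset) :
    (n : ℝ) ^ (Fintype.card V - #Q) * p ^ (#H.edgeFinset - edgesInside H Q) ≤
      max 1 Λ ^ #H.edgeFinset * (n : ℝ) ^ (-σ) := by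
  have h3 := h.sub_mul_le h1 h2
  have hx : (1 : ℝ) ≤ n := by exact_mod_cast hn
  have hx0 : (0 : ℝ) < n := by linarith
  have he : (2 : ℝ) ≤ #H.edgeFinset := by exact_mod_cast h.two_le
  rw [← Nat.cast_sub h2.le, ← Nat.cast_sub (card_le_univ Q)] at h3
  have hb : (1 : ℝ) ≤ ((#H.edgeFinset - edgesInside H Q : ℕ) : ℝ) := by
    exact_mod_cast (by omega : 1 ≤ #H.edgeFinset - edgesInside H Q)
  have hbe : #H.edgeFinset - edgesInside H Q ≤ #H.edgeFinset := Nat.sub_le _ _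
  set a := Fintype.card V - #Q
  set b := #H.edgeFinset - edgesInside H Q
  set v : ℝ := ((Fintype.card V : ℕ) : ℝ)
  set e := #H.edgeFinset
  calc (n : ℝ) ^ a * p ^ b ≤ (n : ℝ) ^ a * (max 1 Λ * (n : ℝ) ^ (-((v - 2) / (e - 1)) - σ)) ^ b := by
        gcongr
        refine hpΛ.trans ?_
        gcongr
        exact le_max_right _ _
    _ = max 1 Λ ^ b * (n : ℝ) ^ (a + (-((v - 2) / (e - 1)) - σ) * b) := by
        rw [mul_pow, Real.rpow_add hx0, Real.rpow_natCast, Real.rpow_mul hx0.le, Real.rpow_natCast]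
        ring
    _ ≤ max 1 Λ ^ e * (n : ℝ) ^ (-σ) := by
        gcongr ?_ * ?_
        · exact pow_le_pow_right₀ (le_max_left _ _) hbe
        · refine Real.rpow_le_rpow_of_exponent_le hx ?_
          have h4 : (a : ℝ) ≤ (v - 2) / (e - 1) * b := by
            rw [div_mul_eq_mul_div, le_div_iff₀ (by linarith)]
            linarith
          nlinarith

/-- The quantity is M/Y with M = n^v p^e, of order μ, and Y = n^#Q p^f with f = e(Q). Strict balance
gives an integer gap fv + 1 ≤ e#Q, so Y^e ≥ M^f n ≥ n, which uses μ ≥ 1. As s ≥ 2, μ is O(log² n)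
and hence O(n^(1/(2e))). -/
theorem StrictlyBalanced.pow_mul_pow_le (h : StrictlyBalanced H) {Λ : ℝ} (hΛ : 0 < Λ) :
    ∃ K : ℝ, 0 < K ∧ ∀ (n : ℕ) (p : unitInterval), Fintype.card V ≤ n → 1 ≤ mean H n p →
      mean H n p ^ (((sParam H : ℝ) - 1) / (sParam H : ℝ)) ≤ Λ * Real.log n →
      ∀ Q : Finset V, 1 ≤ edgesInside H Q → edgesInside H Q < #H.edgeFinset →
        (n : ℝ) ^ (Fintype.card V - #Q) * (p : ℝ) ^ (#H.edgeFinset - edgesInside H Q) ≤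
          K * (n : ℝ) ^ (-(1 / (2 * #H.edgeFinset) : ℝ)) := by
  have hv := two_le_card h.one_le
  have he1 := h.one_le
  set v := Fintype.card V with hvdef
  set e := #H.edgeFinset with hedef
  have he0 : (0 : ℝ) < e := by exact_mod_cast he1
  set cv : ℝ := v ^ v * v.factorial with hcv
  have hcv0 : 0 < cv := by
    have : (0 : ℝ) < v := by exact_mod_cast (by omega : 0 < v)
    have : (0 : ℝ) < v.factorial := by exact_mod_cast v.factorial_pos
    positivity
  refine ⟨cv * (Λ * (4 * e)) ^ 2, by positivity, fun n p hn hm1 hm Q h1 h2 => ?_⟩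
  have hs : 2 ≤ sParam H := two_le_sParam (by omega)
  have hs' : (2 : ℝ) ≤ sParam H := by exact_mod_cast hs
  have hx : (1 : ℝ) ≤ n := by exact_mod_cast (by omega : 1 ≤ n)
  have hx0 : (0 : ℝ) < n := by linarith
  have hp0 : (0 : ℝ) ≤ p := p.2.1
  have hQv : #Q ≤ v := card_le_univ Q
  have hlt := h.edgesInside_mul_lt h1 h2
  set m := mean H n p with hmdef
  set f := edgesInside H Q with hf
  set M : ℝ := (n : ℝ) ^ v * (p : ℝ) ^ e with hM
  rw [← hvdef, ← hedef] at hlt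
  have hmM : m ≤ M := by
    rw [hmdef, mean_eq h.exists_adj, ← hedef, hM]
    gcongr
    exact_mod_cast card_copies_le
  have hMm : M ≤ cv * m := by
    rw [hmdef, mean_eq h.exists_adj, ← hedef, hM, ← mul_assoc]
    gcongr
    rw [hcv, hvdef]
    exact_mod_cast pow_le_card_copies h.exists_adj hn
  have hM1 : 1 ≤ M := hm1.trans hmM
  have hp : (0 : ℝ) < p := by
    refine lt_of_le_of_ne hp0 fun h0 => ?_
    rw [hM, ← h0, zero_pow (by omega), mul_zero] at hM1
    linarith
  set Y : ℝ := (n : ℝ) ^ #Q * (p : ℝ) ^ f with hY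
  have hY0 : 0 < Y := by positivity
  have hYe : (n : ℝ) ^ (1 / e : ℝ) ≤ Y := by
    refine le_of_pow_le_pow_left₀ (by omega : e ≠ 0) hY0.le ?_
    rw [← Real.rpow_natCast, ← Real.rpow_mul hx0.le, one_div_mul_cancel he0.ne', Real.rpow_one]
    obtain ⟨d, hd⟩ := Nat.exists_eq_add_of_lt hlt
    calc (n : ℝ) = 1 * (n : ℝ) ^ 1 := by ring
      _ ≤ M ^ f * (n : ℝ) ^ (d + 1) := by
          gcongr
          · exact one_le_pow₀ hM1
          omega
      _ = (n : ℝ) ^ (f * v + d + 1) * (p : ℝ) ^ (e * f) := by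
          rw [hM, mul_pow, ← pow_mul, ← pow_mul]
          ring
      _ = Y ^ e := by
          rw [← hd, hY, mul_pow, ← pow_mul, ← pow_mul]
          ring_nf
  have hprod : (n : ℝ) ^ (v - #Q) * (p : ℝ) ^ (e - f) * Y = M := by
    rw [hY, hM]
    calc _ = ((n : ℝ) ^ (v - #Q) * (n : ℝ) ^ #Q) * ((p : ℝ) ^ (e - f) * (p : ℝ) ^ f) := by ring
      _ = _ := by rw [← pow_add, ← pow_add, Nat.sub_add_cancel hQv, Nat.sub_add_cancel h2.le]
  have hlog : Real.log n ≤ 4 * e * (n : ℝ) ^ (1 / (4 * e) : ℝ) := by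
    have := Real.log_le_rpow_div hx0.le (by positivity : (0 : ℝ) < 1 / (4 * e))
    rwa [div_div_eq_mul_div, div_one, mul_comm] at this
  have hlog0 : 0 ≤ Real.log n := Real.log_nonneg hx
  have hm2 : m ≤ (Λ * (4 * e)) ^ 2 * (n : ℝ) ^ (1 / (2 * e) : ℝ) := by
    have h3 : m ^ (1 / 2 : ℝ) ≤ Λ * Real.log n := by
      refine le_trans (Real.rpow_le_rpow_of_exponent_le hm1 ?_) hm
      rw [div_le_div_iff₀ (by norm_num) (by linarith)]
      linarith
    calc m = (m ^ (1 / 2 : ℝ)) ^ 2 := by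
          rw [← Real.rpow_natCast, ← Real.rpow_mul (by linarith)]
          norm_num
      _ ≤ (Λ * (4 * e * (n : ℝ) ^ (1 / (4 * e) : ℝ))) ^ 2 := by
          have : 0 ≤ m := by linarith
          gcongr
          exact h3.trans (by gcongr)
      _ = (Λ * (4 * e)) ^ 2 * ((n : ℝ) ^ (1 / (4 * e) : ℝ)) ^ 2 := by ring
      _ = _ := by
          rw [← Real.rpow_natCast ((n : ℝ) ^ _), ← Real.rpow_mul hx0.le]
          congr 2
          field_simp
          norm_num
  calc (n : ℝ) ^ (v - #Q) * (p : ℝ) ^ (e - f) = M / Y := by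
        rw [eq_div_iff hY0.ne', hprod]
    _ ≤ cv * ((Λ * (4 * e)) ^ 2 * (n : ℝ) ^ (1 / (2 * e) : ℝ)) / (n : ℝ) ^ (1 / e : ℝ) := by
        gcongr
        exact hMm.trans (by gcongr)
    _ = cv * (Λ * (4 * e)) ^ 2 * ((n : ℝ) ^ (1 / (2 * e) : ℝ) / (n : ℝ) ^ (1 / e : ℝ)) := by ring
    _ = _ := by
        rw [← Real.rpow_sub hx0]
        congr 2
        field_simp
        norm_num

end Balanced

/-! ### Upper tails for balanced graphs -/

section Main

theorem mean_nonneg {V : Type*} {H : SimpleGraph V} (n : ℕ) (p : unitInterval) : 0 ≤ mean H n p :=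
  integral_nonneg fun _ => Nat.cast_nonneg _

theorem rpow_mul_rpow_one_div {x s : ℝ} (hx : 0 < x) : x ^ (1 / s) * x ^ (2 - 1 / s) = x ^ 2 := by
  rw [← Real.rpow_add hx, add_sub_cancel, ← Real.rpow_natCast]
  norm_num

variable {V : Type*} [Fintype V] {H : SimpleGraph V} [DecidableRel H.Adj]

theorem StrictlyBalanced.upperTail_le (h : StrictlyBalanced H) {Λ : ℝ} (hΛ : 0 < Λ) :
    ∃ c : ℝ, 0 < c ∧ ∀ (n : ℕ) (ε : ℝ) (p : unitInterval), Fintype.card V ≤ n → 0 < ε → ε ≤ Λ →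
      mean H n p ^ (((sParam H : ℝ) - 1) / (sParam H : ℝ)) ≤ Λ * Real.log n →
      upperTail H n p ((1 + ε) * mean H n p) ≤ 3 * Real.exp (-(c * ε ^ 2 * mean H n p)) := by
  classical
  have he := h.one_le
  have hv := two_le_card he
  have hs : 1 ≤ sParam H := one_le_sParam hv
  have hs0 : (1 : ℝ) ≤ sParam H := by exact_mod_cast hs
  obtain ⟨K, hK, hQ⟩ := h.pow_mul_pow_le hΛ
  have he0 : (0 : ℝ) < #H.edgeFinset := by exact_mod_cast he
  set s : ℝ := (sParam H : ℝ)
  obtain ⟨Λ', hΛ'⟩ : ∃ x, x = max Λ (Λ ^ (2 - 1 / s) * Λ) := ⟨_, rfl⟩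
  have hΛ'0 : 0 < Λ' := hΛ' ▸ lt_max_of_lt_left hΛ
  obtain ⟨c, hc, hmain⟩ := upperTail_le_of_edgesInside h.exists_adj hv he hK hΛ'0
    (by positivity : (0 : ℝ) < 1 / (2 * #H.edgeFinset))
  refine ⟨min c (1 / Λ ^ 2), by positivity, fun n ε p hn hε hεΛ hm => ?_⟩
  set m := mean H n p with hmdef
  have hm0 : 0 ≤ m := mean_nonneg n p
  by_cases hm1 : m < 1
  · refine upperTail_le_of_exponent_le ?_
    calc min c (1 / Λ ^ 2) * ε ^ 2 * m ≤ 1 / Λ ^ 2 * Λ ^ 2 * 1 := by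
          gcongr
          exact min_le_right _ _
      _ = 1 := by field_simp
  push Not at hm1
  have hm0' : 0 < m := by linarith
  have hlog : 0 ≤ Real.log n := Real.log_nonneg (by exact_mod_cast (by omega : 1 ≤ n))
  have h1 : (ε * m) ^ 2 / m = ε ^ 2 * m := by field_simp
  have h2 := hmain n (ε * m) p hn (hQ n p hn hm1 hm) (by positivity)
    (by gcongr; rw [hΛ']; exact hεΛ.trans (le_max_left _ _)) ?_
  · rw [one_add_mul]
    refine h2.trans ?_
    rw [h1, ← mul_assoc]
    gcongr
    exact min_le_left _ _
  -- With t = εm, one factor m^((s-1)/s) becomes Λ log n and the surplus ε^(2-1/s) is bounded by a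
  -- constant.
  · have h3 : m = m ^ (1 / s) * m ^ ((s - 1) / s) := by
      rw [← Real.rpow_add hm0', ← add_div, add_sub_cancel, div_self (by linarith), Real.rpow_one]
    have h4 : 0 ≤ 2 - 1 / s := by
      have : 1 / s ≤ 1 := by rw [div_le_one (by linarith)]; exact hs0
      linarith
    rw [← hmdef, h1, Real.mul_rpow hε.le hm0]
    calc ε ^ 2 * m = (ε ^ (1 / s) * ε ^ (2 - 1 / s)) * (m ^ (1 / s) * m ^ ((s - 1) / s)) := by
          rw [rpow_mul_rpow_one_div hε, ← h3]
      _ ≤ (ε ^ (1 / s) * Λ ^ (2 - 1 / s)) * (m ^ (1 / s) * (Λ * Real.log n)) := by gcongr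
      _ = (Λ ^ (2 - 1 / s) * Λ) * (ε ^ (1 / s) * m ^ (1 / s)) * Real.log n := by ring
      _ ≤ _ := by
          gcongr
          rw [hΛ']
          exact le_max_right _ _

/-- A polylogarithmic mean forces p^e ≤ 1/2, since n p^e ≤ n^v p^e = O(μ); then `mean_mul_le_var`
applies. -/
theorem StrictlyBalanced.exists_mean_le_two_mul_var (h : StrictlyBalanced H) :
    ∃ n₀ : ℕ, Fintype.card V ≤ n₀ ∧ ∀ n ≥ n₀, 1 ≤ Real.log n ∧
      ∀ p : unitInterval, mean H n p ≤ Real.log n ^ 2 → mean H n p ≤ 2 * var H n p := by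
  classical
  have hv := two_le_card h.one_le
  set v := Fintype.card V with hvdef
  set cv : ℝ := v ^ v * v.factorial with hcv
  have hcv0 : 0 < cv := by
    have : (0 : ℝ) < v := by exact_mod_cast (by omega : 0 < v)
    have : (0 : ℝ) < v.factorial := by exact_mod_cast v.factorial_pos
    positivity
  have h1 := ((Real.isLittleO_pow_log_id_atTop (n := 2)).comp_tendsto
    tendsto_natCast_atTop_atTop).bound (by positivity : 0 < 1 / (2 * cv))
  have h2 := (Real.tendsto_log_atTop.comp
    (tendsto_natCast_atTop_atTop (R := ℝ))).eventually_ge_atTop 1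
  obtain ⟨n₀, hn₀⟩ := Filter.eventually_atTop.1 (h1.and h2)
  refine ⟨max n₀ v, le_max_right _ _, fun n hn => ?_⟩
  obtain ⟨hl, hlog⟩ := hn₀ n ((le_max_left _ _).trans hn)
  refine ⟨hlog, fun p hm => ?_⟩
  have hvn : v ≤ n := (le_max_right _ _).trans hn
  have hx : (1 : ℝ) ≤ n := by exact_mod_cast (by omega : 1 ≤ n)
  simp only [Function.comp, id, Real.norm_eq_abs, abs_of_nonneg (sq_nonneg (Real.log (n : ℝ))),
    Nat.abs_cast] at hl
  have hvar := mean_mul_le_var (n := n) h.exists_adj p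
  have hm0 := mean_nonneg (H := H) n p
  have hN : (n : ℝ) ^ v ≤ cv * #(copies H n) := by
    rw [hcv, hvdef]
    exact_mod_cast pow_le_card_copies h.exists_adj hvn
  have hpe0 : 0 ≤ (p : ℝ) ^ #H.edgeFinset := pow_nonneg p.2.1 _
  have hpe : (p : ℝ) ^ #H.edgeFinset ≤ 1 / 2 := by
    have h3 : (n : ℝ) * (p : ℝ) ^ #H.edgeFinset ≤ n * (1 / 2) := by
      calc (n : ℝ) * (p : ℝ) ^ #H.edgeFinset ≤ (n : ℝ) ^ v * (p : ℝ) ^ #H.edgeFinset := by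
            gcongr
            exact le_self_pow₀ hx (by omega)
        _ ≤ cv * #(copies H n) * (p : ℝ) ^ #H.edgeFinset := by gcongr
        _ = cv * mean H n p := by rw [mean_eq h.exists_adj]; ring
        _ ≤ cv * (1 / (2 * cv) * n) := by gcongr; exact hm.trans hl
        _ = n * (1 / 2) := by field_simp
    exact le_of_mul_le_mul_left h3 (by linarith)
  nlinarith

theorem StrictlyBalanced.upperTail_le_var (h : StrictlyBalanced H) :
    ∃ (n₀ : ℕ) (c C ξ : ℝ), 0 < c ∧ 0 < C ∧ 0 < ξ ∧
      ∀ (n : ℕ) (t : ℝ) (p : unitInterval), n₀ ≤ n → 0 < t → t ≤ mean H n p →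
        mean H n p ≤ Real.log n ^ (1 + ξ) →
        upperTail H n p (mean H n p + t) ≤ C * Real.exp (-(c * t ^ 2 / var H n p)) := by
  classical
  have hs : 1 ≤ sParam H := one_le_sParam (two_le_card h.one_le)
  have hs0 : (1 : ℝ) ≤ sParam H := by exact_mod_cast hs
  obtain ⟨c, hc, hmain⟩ := h.upperTail_le one_pos
  obtain ⟨n₀, hn₀, hvar⟩ := h.exists_mean_le_two_mul_var
  set s : ℝ := (sParam H : ℝ)
  have hs1 : 1 / s ≤ 1 := by rw [div_le_one (by linarith)]; exact hs0
  -- The choice ξ = 1/s works because (1 + 1/s)(s - 1)/s = 1 - 1/s² ≤ 1, so part (i) applies with Λ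
  -- = 1 and ε = t/μ.
  refine ⟨n₀, c / 2, 3, 1 / s, by positivity, by norm_num, by positivity,
    fun n t p hn ht htm hm => ?_⟩
  obtain ⟨hlog, hvar⟩ := hvar n hn
  set m := mean H n p with hmdef
  have hm0 : 0 < m := by linarith
  have hv : m ≤ 2 * var H n p := by
    refine hvar p (hm.trans ?_)
    rw [← Real.rpow_natCast]
    exact Real.rpow_le_rpow_of_exponent_le hlog (by push_cast; linarith)
  have h1 := hmain n (t / m) p (hn₀.trans hn) (by positivity) (by rwa [div_le_one hm0]) ?_
  · rw [← hmdef, add_mul, one_mul, div_mul_cancel₀ _ hm0.ne'] at h1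
    refine h1.trans ?_
    gcongr
    calc c / 2 * t ^ 2 / var H n p ≤ c / 2 * t ^ 2 / (m / 2) := by
          gcongr
          linarith
      _ = c * (t / m) ^ 2 * m := by field_simp
  · have h2 : 0 ≤ (s - 1) / s := div_nonneg (by linarith) (by linarith)
    rw [one_mul]
    calc m ^ ((s - 1) / s) ≤ (Real.log n ^ (1 + 1 / s)) ^ ((s - 1) / s) := by gcongr
      _ = Real.log n ^ ((1 + 1 / s) * ((s - 1) / s)) := by rw [← Real.rpow_mul (by linarith)]
      _ ≤ Real.log n ^ (1 : ℝ) := by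
          refine Real.rpow_le_rpow_of_exponent_le hlog ?_
          have : (1 + 1 / s) * ((s - 1) / s) = 1 - (1 / s) ^ 2 := by
            have : s ≠ 0 := by linarith
            field_simp
            ring
          rw [this]
          nlinarith [sq_nonneg (1 / s)]
      _ = Real.log n := Real.rpow_one _

theorem TwoBalanced.upperTail_le (h : TwoBalanced H) {σ Λ : ℝ} (hσ : 0 < σ) (hΛ : 0 < Λ) :
    ∃ c : ℝ, 0 < c ∧ ∀ (n : ℕ) (t : ℝ) (p : unitInterval), Fintype.card V ≤ n →
      (p : ℝ) ≤ Λ * (n : ℝ) ^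
        (-(((Fintype.card V : ℝ) - 2) / ((H.edgeSet.ncard : ℝ) - 1)) - σ) →
      0 < t →
      t ≤ Λ * min ((mean H n p * Real.log n) ^ (1 / (2 - 1 / (sParam H : ℝ)))) (mean H n p) →
      upperTail H n p (mean H n p + t) ≤ 3 * Real.exp (-(c * t ^ 2 / mean H n p)) := by
  classical
  have he : 1 ≤ #H.edgeFinset := by have := h.two_le; omega
  have hv := two_le_card he
  have hs0 : (1 : ℝ) ≤ sParam H := by exact_mod_cast one_le_sParam hv
  rw [ncard_edgeSet]
  set s : ℝ := (sParam H : ℝ)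
  obtain ⟨Λ', hΛ'⟩ : ∃ x, x = max Λ (Λ ^ (2 - 1 / s)) := ⟨_, rfl⟩
  have hΛ'0 : 0 < Λ' := hΛ' ▸ lt_max_of_lt_left hΛ
  obtain ⟨c, hc, hmain⟩ := upperTail_le_of_edgesInside h.exists_adj hv he
    (pow_pos (lt_max_of_lt_left one_pos : 0 < max 1 Λ) #H.edgeFinset) hΛ'0 hσ
  refine ⟨c, hc, fun n t p hn hp ht htΛ => ?_⟩
  set m := mean H n p with hmdef
  have hn1 : 1 ≤ n := by omega
  have hlog : 0 ≤ Real.log n := Real.log_nonneg (by exact_mod_cast hn1)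
  have htm : t ≤ Λ * m := htΛ.trans (by gcongr; exact min_le_right _ _)
  have hm0 : 0 < m := by
    by_contra hc
    push Not at hc
    nlinarith
  rw [mul_div_assoc]
  refine hmain n t p hn (fun Q => h.pow_mul_pow_le hn1 p.2.1 hσ hp) ht
    (htm.trans (by gcongr; rw [hΛ']; exact le_max_left _ _)) ?_
  have hs1 : 1 / s ≤ 1 := by rw [div_le_one (by linarith)]; exact hs0
  have ha : 0 < 2 - 1 / s := by linarith
  -- Multiplied by t^(1/s), this is the required t²/μ = O(t^(1/s) log n), which explains the
  -- exponent 1/(2 - 1/s).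
  have h1 : t ^ (2 - 1 / s) ≤ Λ ^ (2 - 1 / s) * (m * Real.log n) := by
    calc t ^ (2 - 1 / s) ≤ (Λ * (m * Real.log n) ^ (1 / (2 - 1 / s))) ^ (2 - 1 / s) := by
          gcongr
          exact htΛ.trans (by gcongr; exact min_le_left _ _)
      _ = _ := by
          rw [Real.mul_rpow hΛ.le (by positivity), ← Real.rpow_mul (by positivity),
            one_div_mul_cancel ha.ne', Real.rpow_one]
  rw [← hmdef, div_le_iff₀ hm0]
  calc t ^ 2 = t ^ (1 / s) * t ^ (2 - 1 / s) := (rpow_mul_rpow_one_div ht).symm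
    _ ≤ t ^ (1 / s) * (Λ' * (m * Real.log n)) := by
        gcongr
        refine h1.trans ?_
        gcongr
        rw [hΛ']
        exact le_max_right _ _
    _ = _ := by ring

end Main

end SubgraphCount

theorem mainTheorem3 {V : Type*} [Fintype V] (H : SimpleGraph V) [DecidableRel H.Adj] :
    -- strictly balanced graphs
    (SubgraphCount.StrictlyBalanced H →
      ∃ C : ℝ, 1 ≤ C ∧ ∀ Λ : ℝ, 0 < Λ → ∃ c : ℝ, 0 < c ∧
        ∀ (n : ℕ) (ε : ℝ) (p : unitInterval), Fintype.card V ≤ n → 0 < ε → ε ≤ Λ →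
          SubgraphCount.mean H n p ^
              (((SubgraphCount.sParam H : ℝ) - 1) / (SubgraphCount.sParam H : ℝ))
            ≤ Λ * Real.log n →
          SubgraphCount.upperTail H n p ((1 + ε) * SubgraphCount.mean H n p)
            ≤ C * Real.exp (-(c * ε ^ 2 * SubgraphCount.mean H n p)))
    ∧
    -- strictly balanced graphs, sub-Gaussian tails in terms of the variance
    (SubgraphCount.StrictlyBalanced H →
      ∃ (n₀ : ℕ) (c C ξ : ℝ), 0 < c ∧ 0 < C ∧ 0 < ξ ∧
        ∀ (n : ℕ) (t : ℝ) (p : unitInterval), n₀ ≤ n → 0 < t →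
          t ≤ SubgraphCount.mean H n p →
          SubgraphCount.mean H n p ≤ Real.log n ^ (1 + ξ) →
          SubgraphCount.upperTail H n p (SubgraphCount.mean H n p + t)
            ≤ C * Real.exp (-(c * t ^ 2 / SubgraphCount.var H n p)))
    ∧
    -- 2-balanced graphs
    (SubgraphCount.TwoBalanced H →
      ∃ C : ℝ, 1 ≤ C ∧ ∀ σ Λ : ℝ, 0 < σ → 0 < Λ → ∃ c : ℝ, 0 < c ∧
        ∀ (n : ℕ) (t : ℝ) (p : unitInterval), Fintype.card V ≤ n →
          (p : ℝ) ≤ Λ * (n : ℝ) ^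
            (-(((Fintype.card V : ℝ) - 2) / ((H.edgeSet.ncard : ℝ) - 1)) - σ) →
          0 < t →
          t ≤ Λ * min ((SubgraphCount.mean H n p * Real.log n) ^
              (1 / (2 - 1 / (SubgraphCount.sParam H : ℝ))))
            (SubgraphCount.mean H n p) →
          SubgraphCount.upperTail H n p (SubgraphCount.mean H n p + t)
            ≤ C * Real.exp (-(c * t ^ 2 / SubgraphCount.mean H n p))) := by
  refine ⟨fun h => ⟨3, by norm_num, fun Λ hΛ => h.upperTail_le hΛ⟩, fun h => h.upperTail_le_var,
    fun h => ⟨3, by norm_num, fun σ Λ hσ hΛ => h.upperTail_le hσ hΛ⟩⟩
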